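/- Let $n\ge 3$, let $\sigma_1,\sigma_2\in\mathbb C^2$ be fixed spinors with $(12)\neq0$, where $(ij)=\sigma_i^0\sigma_j^1-\sigma_i^1\sigma_j^0$, and let $\xi\in\mathbb C^2\setminus\{0\}$ be a reference spinor. Let $\sigma_3,\dots,\sigma_n$ be variable spinors, $X^I_A$ ($A=0,1$; $I$ running over $4$ even and $4$ odd directions) coordinates on $\mathbb C^{8|8}$, $Z(\sigma)=X_A\sigma^A$, and $W_1,\dots,W_n$ dual twistors with $4$ even and $4$ odd components, regarded as formal variables. For $\Lambda=s^2$ let $\langle C,D\rangle=I_{IJ}C^ID^J$ with $I_{IJ}=\mathrm{diag}(\epsilon,\Lambda\epsilon,s\,\mathbb 1_4)$, let $[\cdot,\cdot]$ be the contraction with $I^{IJ}$, which is $\Lambda$ times the (graded) inverse of $I_{IJ}$, and define $X^2$ by $\langle Z(\sigma),Z(\sigma')\rangle=X^2(\sigma\sigma')$. For a spinor $\zeta$ let $\mathbb H$ be the $n\times n$ Hodges matrix $$\mathbb H_{ij}=-\frac{[W_i,W_j]}{(ij)}\ (i\ne j),\qquad \mathbb H_{ii}=-\sum_{j\neq i}\mathbb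 H_{ij}\frac{(\zeta j)^2}{(\zeta i)^2},$$ with $\zeta=\xi$ unless stated otherwise; let $|\mathbb H^{R}_{C}|$ be its determinant with the rows $R$ and columns $C$ removed (taken with its sign as a cofactor if $R\ne C$), and for $p=1,2$ let $$\omega^p_{ij}=\Lambda\frac{[W_i,W_j](p\xi)^4(ij)}{(pi)^2(pj)^2(\xi i)^2(\xi j)^2}.$$ Write $\int F$ for $\int \frac{d^{8|8}X\,d^{2n}\sigma}{\mathrm{vol}\,GL(2)}\,F\,e^{i\mathcal P\cdot X}$, $\mathcal P\cdot X=\sum_i W_i\cdot Z(\sigma_i)$, where $GL(2)$ is fixed by fixing $\sigma_1,\sigma_2$ (Faddeev–Popov factor $(12)^2$) and where the integral is understood as the class of the integrand modulo total derivatives in $X$ and $\sigma_3,\dots,\sigma_n$; integrands are polynomial in $X$, $W$ and rational in the $\sigma_i$ with poles only at $(ij)=0$ and $(\xi i)=0$. For $\Lambda\neq0$ the MHV amplitude with cosmological constant $\Lambda$ is $$\mathcal M_{n,0}(\Lambda)=\frac1\Lambda\int\Big[(X^2)^2\,|\mathbb H^{12}_{12}|+\sum_{i,j,k,l}\omega^1_{ij}\,\omega^2_{kl}\,|\mathbb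 H^{12ijkl}_{12ijkl}|\Big],$$ the sum being over pairwise distinct $i,j,k,l\in\{3,\dots,n\}$. Then: 1. (Thrice-reduced form.) For every $s\ne0$ and every $i\in\{3,\dots,n\}$, $$\mathcal M_{n,0}(\Lambda)=\int\Big[-2\,X^2\,\frac{(12)^2}{(1i)^2(2i)^2}\,|\mathbb H^{12i}_{12i}|+\frac1\Lambda\sum_{i',j,k,l}\omega^1_{i'j}\,\omega^2_{kl}\,|\mathbb H^{12i'jkl}_{12i'jkl}|\Big],$$ where $\omega^1\omega^2/\Lambda=O(\Lambda)$, so that no negative power of $\Lambda$ remains. 2. (No singularity at $\Lambda=0$.) $\mathcal M_{n,0}(\Lambda)$ is a polynomial in $s=\sqrt\Lambda$ whose coefficients are independent of $s$. 3. (Flat-space limit.) Its value at $\Lambda=0$ is, up to the numerical factor $-2$, Hodges' formula: for every $i\in\{3,\dots,n\}$, with $X^2$, $\mathbb H$ taken at $\Lambda=0$ and with any reference spinor $\zeta$ for which the $(\zeta j)$, $3\le j\le n$, are invertible functions (for example $\zeta=\xi$ or $\zeta=\sigma_1$), $$\lim_{\Lambda\to0}\mathcal M_{n,0}(\Lambda)=-2\int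 X^2\,\frac{(12)^2}{(1i)^2(2i)^2}\,|\mathbb H^{12i}_{12i}| =\frac{-2}{(n-1)(n-2)}\int X^2\Big[\sum_{i,j=3}^n\frac{(12)^2}{(1i)(1j)(2i)(2j)}\,|\mathbb H^{12i}_{12j}|+\sum_{i=3}^n\frac{(12)^2}{(1i)^2(2i)^2}\,|\mathbb H^{12i}_{12i}|\Big].$$ (At $\Lambda=0$, $X^2$ is the determinant of the part of $X$ that can be normalized to the identity by $GL(2)$ instead of fixing $\sigma_1,\sigma_2$; in that normalization $X^2=1$.) -/

import Mathlib

/-!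
Conventions.  There are `n = m + 2` particles: `Sum.inl 0`, `Sum.inl 1` are the two particles
`1, 2` of negative helicity, and `Sum.inr i`, `i : Fin m`, are the remaining `n - 2` particles.
`Λ = s ^ 2`, so that `s` is the square root of the cosmological constant that occurs in the
fermionic part of the infinity twistor.

The group `GL(2)` is fixed by fixing the spinors `σ₁, σ₂` (the parameter `τ`), with
Faddeev-Popov factor `(12) ^ 2`; the remaining integration variables are `X` (8 even and 8 odd
coordinates) and `σᵢ` for the other particles.  An integral is the class of its integrand
`F * exp (i P · X)` modulo total derivatives in the integration variables.
The dual twistors `Wᵢ` are not integrated; they are formal variables (acting as `-i ∂/∂Zᵢ` on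
arbitrary twistor wave functions).
-/

open scoped TensorProduct

noncomputable section

namespace MHV

/-- The particles: two of negative helicity, `m` of positive helicity. -/
abbrev Particle (m : ℕ) : Type := Fin 2 ⊕ Fin m

/-- The even variables: bosonic parts of the `Wᵢ` and of `X`, and the spinors `σᵢ`. -/
inductive EvenVar (m : ℕ) : Type
  | W (i : Particle m) (α : Fin 4)
  | X (α : Fin 4) (A : Fin 2)
  | sig (i : Fin m) (A : Fin 2)

/-- The odd variables: fermionic parts of the `Wᵢ` and of `X`. -/
inductive OddVar (m : ℕ) : Type
  | W (i : Particle m) (a : Fin 4)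
  | X (a : Fin 4) (A : Fin 2)

/-- The `SL(2)`-invariant product `(u v)` of two spinors. -/
def br {R : Type*} [CommRing R] (u v : Fin 2 → R) : R := u 0 * v 1 - u 1 * v 0

/-! ### Extending a derivation to a localization -/

section Localization

variable {A : Type} [CommRing A] [Algebra ℂ A]

/-- `a ↦ a + ε D a`, as a map to the dual numbers over the localization. -/
def dualHom (M : Submonoid A) (D : Derivation ℂ A A) :
    A →+* TrivSqZeroExt (Localization M) (Localization M) where
  toFun a := TrivSqZeroExt.inl (algebraMap A (Localization M) a) +
    TrivSqZeroExt.inr (algebraMap A (Localization M) (D a))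
  map_one' := by ext <;> simp
  map_zero' := by ext <;> simp
  map_add' a b := by ext <;> simp [add_smul]
  map_mul' a b := by
    ext
    · simp
    · simp only [TrivSqZeroExt.snd_add, TrivSqZeroExt.snd_inl, TrivSqZeroExt.snd_inr,
        TrivSqZeroExt.snd_mul, TrivSqZeroExt.fst_add, TrivSqZeroExt.fst_inl,
        TrivSqZeroExt.fst_inr, zero_add, add_zero, Derivation.leibniz, map_add, map_mul,
        smul_eq_mul, op_smul_eq_smul]

theorem dualHom_isUnit (M : Submonoid A) (D : Derivation ℂ A A) (y : M) :
    IsUnit (dualHom M D y) := by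
  rw [TrivSqZeroExt.isUnit_iff_isUnit_fst]
  simpa [dualHom] using IsLocalization.map_units (Localization M) y

/-- The extension of `dualHom` to the localization. -/
def dualLift (M : Submonoid A) (D : Derivation ℂ A A) :
    Localization M →+* TrivSqZeroExt (Localization M) (Localization M) :=
  IsLocalization.lift (M := M) (dualHom_isUnit M D)

theorem dualLift_algebraMap (M : Submonoid A) (D : Derivation ℂ A A) (a : A) :
    dualLift M D (algebraMap A (Localization M) a) = dualHom M D a :=
  IsLocalization.lift_eq _ a

theorem fst_dualLift (M : Submonoid A) (D : Derivation ℂ A A) (x : Localization M) :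
    (dualLift M D x).fst = x := by
  have h : ((TrivSqZeroExt.fstHom (Localization M) (Localization M)
      (Localization M)).toRingHom.comp (dualLift M D)) = RingHom.id _ := by
    apply IsLocalization.ringHom_ext M
    ext a
    simp [dualLift_algebraMap, dualHom]
  exact congrArg (fun f : Localization M →+* Localization M => f x) h

/-- The unique extension of the derivation `D` of `A` to a localization of `A`. -/
def locDer (M : Submonoid A) (D : Derivation ℂ A A) :
    Derivation ℂ (Localization M) (Localization M) :=
  Derivation.mk'
    { toFun := fun x => (dualLift M D x).snd
      map_add' := fun x y => by simp
      map_smul' := fun c x => by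
        have hc : dualLift M D (algebraMap ℂ (Localization M) c) =
            TrivSqZeroExt.inl (algebraMap ℂ (Localization M) c) := by
          rw [IsScalarTower.algebraMap_apply ℂ A (Localization M), dualLift_algebraMap]
          ext <;> simp [dualHom]
        rw [Algebra.smul_def, map_mul, hc]
        simp [Algebra.smul_def] }
    (fun x y => by simp [fst_dualLift, mul_comm])

theorem locDer_algebraMap (M : Submonoid A) (D : Derivation ℂ A A) (a : A) :
    locDer M D (algebraMap A (Localization M) a) = algebraMap A (Localization M) (D a) := by
  change (dualLift M D (algebraMap A (Localization M) a)).snd = _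
  rw [dualLift_algebraMap]
  change (TrivSqZeroExt.inl (algebraMap A (Localization M) a) +
    TrivSqZeroExt.inr (algebraMap A (Localization M) (D a)) :
      TrivSqZeroExt (Localization M) (Localization M)).snd = _
  rw [TrivSqZeroExt.snd_add, TrivSqZeroExt.snd_inl, TrivSqZeroExt.snd_inr, zero_add]

end Localization

/-! ### The algebra of integrands -/

section Integrands

variable (m : ℕ) (τ : Fin 2 → Fin 2 → ℂ) (ξ : Fin 2 → ℂ)

/-- The spinors `σ₁, …, σₙ` over the polynomial ring. -/
def sigPoly : Particle m → Fin 2 → MvPolynomial (EvenVar m) ℂ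
  | Sum.inl a => fun A => MvPolynomial.C (τ a A)
  | Sum.inr i => fun A => MvPolynomial.X (EvenVar.sig i A)

/-- The product of all the denominators `(1i)`, `(2i)`, `(ξi)`, `(ij)` that are allowed. -/
def denom : MvPolynomial (EvenVar m) ℂ :=
  (∏ i : Fin m, br (sigPoly m τ (Sum.inl 0)) (sigPoly m τ (Sum.inr i)) *
      br (sigPoly m τ (Sum.inl 1)) (sigPoly m τ (Sum.inr i)) *
      br (fun A => MvPolynomial.C (ξ A)) (sigPoly m τ (Sum.inr i))) *
    ∏ p : Fin m × Fin m with p.1 < p.2,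
      br (sigPoly m τ (Sum.inr p.1)) (sigPoly m τ (Sum.inr p.2))

/-- The functions of the even variables: polynomial in `W`, `X`, rational in the `σᵢ` with poles
only where two of the spinors `σ₁, …, σₙ`, `ξ` become proportional. -/
abbrev EvenFun : Type := Localization (Submonoid.powers (denom m τ ξ))

/-- The Grassmann algebra of the odd variables. -/
abbrev Grass : Type := ExteriorAlgebra ℂ (OddVar m →₀ ℂ)

/-- The algebra of integrands. -/
abbrev Integrand : Type := EvenFun m τ ξ ⊗[ℂ] Grass m

/-- The centre of the algebra of integrands, a commutative ring that contains all its even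
elements. -/
abbrev Even : Type := Subalgebra.center ℂ (Integrand m τ ξ)

/-- An odd variable as an element of the Grassmann algebra. -/
def odd (v : OddVar m) : Grass m := ExteriorAlgebra.ι ℂ (Finsupp.single v 1)

theorem odd_mul_odd_comm (u v : OddVar m) (g : Grass m) :
    odd m u * odd m v * g = g * (odd m u * odd m v) := by
  have key : ∀ x y : OddVar m →₀ ℂ, ExteriorAlgebra.ι ℂ x * ExteriorAlgebra.ι ℂ y =
      -(ExteriorAlgebra.ι ℂ y * ExteriorAlgebra.ι ℂ x) := fun x y =>
    eq_neg_of_add_eq_zero_left (ExteriorAlgebra.ι_add_mul_swap x y)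
  induction g using ExteriorAlgebra.induction with
  | algebraMap r => exact (Algebra.commutes r _).symm
  | ι x =>
    rw [odd, odd, mul_assoc, key _ x, mul_neg, ← mul_assoc, key _ x, neg_mul, neg_neg, mul_assoc]
  | mul a b ha hb => rw [← mul_assoc, ha, mul_assoc, hb, mul_assoc]
  | add a b ha hb => rw [mul_add, ha, hb, add_mul]

variable {m τ ξ}

/-- A function of the even variables as an integrand. -/
def ev (f : EvenFun m τ ξ) : Even m τ ξ :=
  ⟨f ⊗ₜ[ℂ] 1, by
    rw [Subalgebra.mem_center_iff]
    intro b
    induction b using TensorProduct.induction_on with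
    | zero => simp
    | tmul x y => simp [Algebra.TensorProduct.tmul_mul_tmul, mul_comm]
    | add x y hx hy => rw [add_mul, mul_add, hx, hy]⟩

/-- The product of two odd variables as an integrand. -/
def oddProd (u v : OddVar m) : Even m τ ξ :=
  ⟨1 ⊗ₜ[ℂ] (odd m u * odd m v), by
    rw [Subalgebra.mem_center_iff]
    intro b
    induction b using TensorProduct.induction_on with
    | zero => simp
    | tmul x y => simp [Algebra.TensorProduct.tmul_mul_tmul, odd_mul_odd_comm]
    | add x y hx hy => rw [add_mul, mul_add, hx, hy]⟩

/-- An even variable as a function. -/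
def evar (v : EvenVar m) : EvenFun m τ ξ :=
  algebraMap (MvPolynomial (EvenVar m) ℂ) (EvenFun m τ ξ) (MvPolynomial.X v)

/-- The spinor `σᵢ`. -/
def sig (i : Particle m) (A : Fin 2) : EvenFun m τ ξ :=
  algebraMap (MvPolynomial (EvenVar m) ℂ) (EvenFun m τ ξ) (sigPoly m τ i A)

/-- A constant spinor. -/
def cst (ζ : Fin 2 → ℂ) (A : Fin 2) : EvenFun m τ ξ := algebraMap ℂ (EvenFun m τ ξ) (ζ A)

variable (m τ ξ)

/-- The exponent `i P · X`, where `P · X = ∑ᵢ Wᵢ · Z(σᵢ)` and `Z(σ) = X_A σ^A`. -/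
def expo : Even m τ ξ :=
  Complex.I • ∑ i : Particle m, ∑ A : Fin 2, ev (sig i A) *
    ((∑ α : Fin 4, ev (evar (EvenVar.W i α) * evar (EvenVar.X α A))) +
      ∑ a : Fin 4, oddProd (OddVar.W i a) (OddVar.X a A))

/-- The integration variables: the even and odd coordinates `X`, and the spinors `σᵢ` of the
particles other than `1, 2`. -/
inductive IntVar (m : ℕ) : Type
  | even (α : Fin 4) (A : Fin 2)
  | odd (a : Fin 4) (A : Fin 2)
  | sig (i : Fin m) (A : Fin 2)

/-- The partial derivative of a function of the even variables. -/
def evenDer (v : EvenVar m) : Derivation ℂ (EvenFun m τ ξ) (EvenFun m τ ξ) :=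
  locDer (Submonoid.powers (denom m τ ξ)) (MvPolynomial.pderiv v)

/-- The (left) partial derivative with respect to an integration variable. -/
def partialDer : IntVar m → (Integrand m τ ξ →ₗ[ℂ] Integrand m τ ξ)
  | IntVar.even α A =>
      LinearMap.rTensor (Grass m) (evenDer m τ ξ (EvenVar.X α A)).toLinearMap
  | IntVar.odd a A =>
      LinearMap.lTensor (EvenFun m τ ξ)
        (CliffordAlgebra.contractLeft (Q := (0 : QuadraticForm ℂ (OddVar m →₀ ℂ)))
          (Finsupp.lapply (OddVar.X a A)))
  | IntVar.sig i A =>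
      LinearMap.rTensor (Grass m) (evenDer m τ ξ (EvenVar.sig i A)).toLinearMap

/-- `F ↦ ∂F + ∂(i P · X) F`: the total derivative `∂ (F exp (i P · X))`, with the exponential
factored out. -/
def totalDer (v : IntVar m) : Integrand m τ ξ →ₗ[ℂ] Integrand m τ ξ :=
  partialDer m τ ξ v +
    LinearMap.mulLeft ℂ (partialDer m τ ξ v (expo m τ ξ : Integrand m τ ξ))

/-- The space of sums of total derivatives. -/
def totalDerivatives : Submodule ℂ (Integrand m τ ξ) :=
  ⨆ v : IntVar m, LinearMap.range (totalDer m τ ξ v)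

/-- Values of integrals: integrands modulo total derivatives. -/
abbrev IntegralValue : Type := Integrand m τ ξ ⧸ totalDerivatives m τ ξ

variable {m τ ξ}

/-- `∫ d^{8|8}X ∏ d²σᵢ / vol GL(2)` of `F exp (i P · X)`, with `σ₁, σ₂` fixed and with the
Faddeev-Popov factor `(12) ^ 2`. -/
def integral (F : Even m τ ξ) : IntegralValue m τ ξ :=
  (totalDerivatives m τ ξ).mkQ
    ((ev (br (sig (Sum.inl 0)) (sig (Sum.inl 1)) ^ 2) * F : Even m τ ξ) : Integrand m τ ξ)

end Integrands

/-! ### The infinity twistor and the ingredients of the amplitude -/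

/-- The bosonic part of `I_{IJ}`. -/
def infLower (Λ : ℂ) : Matrix (Fin 4) (Fin 4) ℂ :=
  !![0, 1, 0, 0; -1, 0, 0, 0; 0, 0, 0, Λ; 0, 0, -Λ, 0]

/-- The bosonic part of `I^{IJ}`. -/
def infUpper (Λ : ℂ) : Matrix (Fin 4) (Fin 4) ℂ :=
  !![0, -Λ, 0, 0; Λ, 0, 0, 0; 0, 0, 0, -1; 0, 0, 1, 0]

theorem infLower_mul_infUpper (Λ : ℂ) : infLower Λ * infUpper Λ = Λ • 1 := by
  ext i j
  fin_cases i <;> fin_cases j <;>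
    simp [infLower, infUpper, Matrix.mul_apply, Fin.sum_univ_four]

section Amplitude

variable {m : ℕ} {τ : Fin 2 → Fin 2 → ℂ} {ξ : Fin 2 → ℂ}

/-- `[Wᵢ, Wⱼ]`, the contraction with `I^{IJ}`.  The fermionic part has the sign for which
`I^{IJ}` is `Λ` times the graded inverse of `I_{IJ}`: if `W = ⟨C, ·⟩` and `W' = ⟨D, ·⟩`, then
`[W, W'] = - Λ ⟨C, D⟩` in the fermionic directions as in the bosonic ones. -/
def wbr (s : ℂ) (i j : Particle m) : Even m τ ξ :=
  (∑ α : Fin 4, ∑ β : Fin 4, infUpper (s ^ 2) α β •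
      ev (evar (EvenVar.W i α) * evar (EvenVar.W j β))) -
    s • ∑ a : Fin 4, oddProd (OddVar.W i a) (OddVar.W j a)

/-- `X²`, normalized by `⟨Z(σ), Z(σ')⟩ = X² (σ σ')`, so that `⟨Z, dZ⟩ = X² (σ dσ)`. -/
def xsq (s : ℂ) : Even m τ ξ :=
  (∑ α : Fin 4, ∑ β : Fin 4, infLower (s ^ 2) α β •
      ev (evar (EvenVar.X α 0) * evar (EvenVar.X β 1))) +
    s • ∑ a : Fin 4, oddProd (OddVar.X a 0) (OddVar.X a 1)

/-- The product `(ij)`. -/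
def sbr (i j : Particle m) : EvenFun m τ ξ := br (sig i) (sig j)

/-- The product `(ζ i)` with a constant spinor `ζ`. -/
def rbr (ζ : Fin 2 → ℂ) (i : Particle m) : EvenFun m τ ξ := br (cst ζ) (sig i)

/-- The off-diagonal entries `- [Wᵢ, Wⱼ] / (ij)` of the Hodges matrix. -/
def hodgesOff (s : ℂ) (i j : Particle m) : Even m τ ξ :=
  -(wbr s i j * ev (Ring.inverse (sbr i j)))

/-- The `n × n` Hodges matrix with reference spinor `ζ`. -/
def hodges (s : ℂ) (ζ : Fin 2 → ℂ) : Matrix (Particle m) (Particle m) (Even m τ ξ) :=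
  fun i j => if i = j then
      -∑ k ∈ Finset.univ.erase i,
        hodgesOff s i k * ev (rbr ζ k ^ 2 * Ring.inverse (rbr ζ i) ^ 2)
    else hodgesOff s i j

/-- The determinant of the Hodges matrix after removal of the rows and columns `1`, `2` and of
those in `T`. -/
def reduced (s : ℂ) (ζ : Fin 2 → ℂ) (T : Finset (Fin m)) : Even m τ ξ :=
  ((hodges s ζ).submatrix (fun i : {i : Fin m // i ∉ T} => Sum.inr i.1)
    (fun i : {i : Fin m // i ∉ T} => Sum.inr i.1)).det

/-- The determinant of the Hodges matrix after removal of the rows `1, 2, i` and the columns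
`1, 2, j`, with its sign as a cofactor. -/
def reducedOff (s : ℂ) (ζ : Fin 2 → ℂ) (i j : Fin m) : Even m τ ξ :=
  ((hodges s ζ).submatrix (fun i : Fin m => Sum.inr i)
    (fun i : Fin m => Sum.inr i)).adjugate j i

/-- The propagators `ω¹` (for `p = 0`) and `ω²` (for `p = 1`) to the contact structure. -/
def omega (s : ℂ) (p : Fin 2) (i j : Fin m) : Even m τ ξ :=
  s ^ 2 • (wbr s (Sum.inr i) (Sum.inr j) *
    ev (rbr ξ (Sum.inl p) ^ 4 * sbr (Sum.inr i) (Sum.inr j) *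
      Ring.inverse (sbr (Sum.inl p) (Sum.inr i)) ^ 2 *
      Ring.inverse (sbr (Sum.inl p) (Sum.inr j)) ^ 2 *
      Ring.inverse (rbr ξ (Sum.inr i)) ^ 2 * Ring.inverse (rbr ξ (Sum.inr j)) ^ 2))

/-- The term `∑ ω¹_{ij} ω²_{kl} |H^{12ijkl}_{12ijkl}|`, summed over pairwise distinct indices. -/
def omegaTerm (s : ℂ) : Even m τ ξ :=
  ∑ t : Fin 4 ↪ Fin m, omega s 0 (t 0) (t 1) * omega s 1 (t 2) (t 3) *
    reduced s ξ (Finset.univ.map t)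

/-- The factor `(12)² / ((1i) (1j) (2i) (2j))`. -/
def coeff (i j : Fin m) : Even m τ ξ :=
  ev (sbr (Sum.inl 0) (Sum.inl 1) ^ 2 *
    Ring.inverse (sbr (Sum.inl 0) (Sum.inr i)) * Ring.inverse (sbr (Sum.inl 0) (Sum.inr j)) *
    Ring.inverse (sbr (Sum.inl 1) (Sum.inr i)) * Ring.inverse (sbr (Sum.inl 1) (Sum.inr j)))

variable (m τ ξ)

/-- The MHV amplitude with cosmological constant `Λ = s ^ 2`. -/
def amplitude (s : ℂ) : IntegralValue m τ ξ :=
  (s ^ 2)⁻¹ • integral (xsq s ^ 2 * reduced s ξ ∅ + omegaTerm s)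

/-- The thrice-reduced form of the amplitude, with distinguished particle `i`. -/
def thriceReduced (s : ℂ) (i : Fin m) : IntegralValue m τ ξ :=
  integral ((-2 : ℂ) • (xsq s * coeff i i * reduced s ξ {i}) + (s ^ 2)⁻¹ • omegaTerm s)

/-- Hodges' formula (reference spinor `ζ`, distinguished particle `i`).  The factor `X²` at
`Λ = 0` does not involve the space-time coordinates: it is the determinant of the part of `X`
that can be set to the identity, instead of fixing `σ₁, σ₂`, and `X² = 1` then. -/
def hodgesAmplitude (ζ : Fin 2 → ℂ) (i : Fin m) : IntegralValue m τ ξ :=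
  integral (xsq 0 * coeff i i * reduced 0 ζ {i})

/-- The flat-space formula as a sum over all thrice-reduced determinants. -/
def flatSum (ζ : Fin 2 → ℂ) : IntegralValue m τ ξ :=
  integral (xsq 0 * (∑ i : Fin m, ∑ j : Fin m, coeff i j * reducedOff 0 ζ i j +
    ∑ i : Fin m, coeff i i * reduced 0 ζ {i}))

end Amplitude

end MHV

end

/-! Write `H` for the Hodges matrix without the rows and columns of particles 1 and 2, and `v` for
the vector `v_k = (1k)(2k)`. The vector is null for `H` up to momentum: `(H v)_i = (ζi)^{-2} [W_i,
P(η_i)]` for an explicit spinor `η_i` (`core_mulVec_nullVec`). By Cramer's rule `det H` is therefore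
a combination of the `[W_i, P(η_i)]` with coefficients `(ξi)^{-2} adj(H)_{ki} / v_k`
(`det_core_eq`).

A momentum factor can be integrated away. It is produced by `[W_i, ∂/∂X]` acting on the exponential;
moved onto `(X²)²`, this operator gives `2 Λ X²` times `W_i · X_A`, because `I^{IJ}` and `I_{IJ}`
are inverse up to `Λ`. That factor is what `∂/∂σ_i` brings down from the exponential, so a second
integration by parts turns it into a divergence in `σ_i` (`xsqE_sq_mul_momentumAt_mem`). The
explicit `Λ` cancels the prefactor `1/Λ` of the amplitude.

What remains is to compute `∑_i ∂_{σ_i} · (η_i (ξi)^{-2} adj(H)_{ki} / v_k)`. Along `η_i` the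
off-diagonal entries `H_ij` scale by factors antisymmetric in `i, j`, and the diagonal responds in a
compensating way. For such derivations the divergence of a column of the adjugate is pure linear
algebra (`Matrix.sum_derivation_adjugate`); the terms left over combine to `-(12)² adj(H)_{kk} /
v_k²` (`sum_divergence`). This is the thrice-reduced form.

The `ω` term carries `Λ²`, so after division by `Λ` every ingredient of the thrice-reduced integrand
is polynomial in `s`, and its value at `s = 0` is the Hodges term. At `Λ = 0` the operator `[W_i,
∂/∂X]` annihilates `X²`, so momentum times `X²` integrates to zero and `v` becomes a true null
vector modulo total derivatives. A symmetric matrix with null vector `v` has adjugate proportional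
to `v vᵀ`, and its diagonal is fixed by the rest when the entries of `v` are invertible. Hence the
normalized minors depend neither on the removed rows and columns nor on the reference spinor
(`Matrix.adjugate_sub_mem_of_mulVec_mem`), which gives both flat-space formulas. -/

open scoped TensorProduct

noncomputable section

/-! ### Adjugates of matrices with a null vector. -/

namespace Matrix

variable {ι A : Type*} [Fintype ι] [DecidableEq ι] [CommRing A]

/-- The diagonal entries of the adjugate are the principal minors. -/
theorem det_submatrix_compl_singleton (M : Matrix ι ι A) (i : ι) :
    (M.submatrix (fun j : {j // j ∉ ({i} : Finset ι)} => j.1)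
      (fun j : {j // j ∉ ({i} : Finset ι)} => j.1)).det = M.adjugate i i := by
  rw [adjugate_apply, twoBlockTriangular_det _ (fun j => j ∉ ({i} : Finset ι))]
  · have : Unique {j // ¬ j ∉ ({i} : Finset ι)} :=
      ⟨⟨⟨i, by simp⟩⟩, fun j => Subtype.ext (by simpa using j.2)⟩
    have h2 : (toSquareBlockProp (M.updateRow i (Pi.single i 1))
        (fun j => ¬ j ∉ ({i} : Finset ι))).det = 1 := by
      rw [det_unique]
      have hd : ((default : {j // ¬ j ∉ ({i} : Finset ι)}) : ι) = i := by
        simpa using (default : {j // ¬ j ∉ ({i} : Finset ι)}).2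
      simp [toSquareBlockProp_def, hd]
    rw [h2, mul_one]
    congr 1
    ext a b
    have ha : a.1 ≠ i := by simpa using a.2
    simp [toSquareBlockProp_def, updateRow_ne ha]
  · intro a ha b hb
    obtain rfl : a = i := by simpa using ha
    have : b ≠ a := by simpa using hb
    simp [this]

/-- The determinant after replacing a row by an arbitrary vector, expanded along that row. -/
theorem det_updateRow_eq_sum (M : Matrix ι ι A) (i : ι) (r : ι → A) :
    (M.updateRow i r).det = ∑ j, r j * M.adjugate j i := by
  rw [det_eq_sum_mul_adjugate_row _ i]
  refine Finset.sum_congr rfl fun j _ => ?_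
  rw [adjugate_apply, adjugate_apply, updateRow_idem, updateRow_self]

/-- Cramer's rule: if row `i` is replaced by the basis vector `e_a`, the new matrix sends `v` to
`v_a e_i`, and its determinant is the cofactor `adj_{ai}`. Column `i` of the adjugate does not see
row `i`, so multiplying by the new adjugate gives the relation without any division. -/
theorem adjugate_mul_of_mulVec_eq_zero {M : Matrix ι ι A} {v : ι → A} (h : M *ᵥ v = 0)
    (a b i : ι) : M.adjugate a i * v b = v a * M.adjugate b i := by
  set N := M.updateRow i (Pi.single a 1) with hN
  have hNv : N *ᵥ v = Pi.single i (v a) := by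
    ext j
    rcases eq_or_ne j i with rfl | hj
    · simp [hN, mulVec]
    · have := congrFun h j
      simpa [hN, mulVec, updateRow_ne hj, hj] using this
  have h1 : N.adjugate *ᵥ (N *ᵥ v) = N.det • v := by
    rw [mulVec_mulVec, adjugate_mul, smul_mulVec, one_mulVec]
  have h2 := congrFun h1 b
  rw [hNv] at h2
  simp only [mulVec_single, Pi.smul_apply, smul_eq_mul, MulOpposite.smul_eq_mul_unop,
    MulOpposite.unop_op, col_apply] at h2
  have h3 : N.adjugate b i = M.adjugate b i := by
    rw [adjugate_apply, adjugate_apply, hN, updateRow_idem]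
  rw [adjugate_apply M a i, ← hN, ← h2, h3, mul_comm]

/-- The division-free form of `adj ∝ v vᵀ`: the proportionality is applied once to each index,
symmetry exchanging the two. -/
theorem adjugate_mul_mul_of_mulVec_eq_zero {M : Matrix ι ι A} (hM : M.IsSymm) {v : ι → A}
    (h : M *ᵥ v = 0) (a b c d : ι) :
    M.adjugate a b * (v c * v d) = v a * v b * M.adjugate c d := by
  have hs : ∀ x y, M.adjugate x y = M.adjugate y x := fun x y => hM.adjugate.apply y x
  have h1 := adjugate_mul_of_mulVec_eq_zero h a c b
  have h2 := adjugate_mul_of_mulVec_eq_zero h b d c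
  rw [← mul_assoc, h1, hs c b, mul_assoc, h2, hs d c, mul_assoc]

end Matrix

/-! ### Derivatives of determinants and adjugates. -/

namespace Derivation

variable {R ι A : Type*} [Fintype ι] [DecidableEq ι] [CommRing R] [CommRing A] [Algebra R A]

theorem map_finset_prod {κ : Type*} [DecidableEq κ] (D : Derivation R A A) (s : Finset κ)
    (f : κ → A) :
    D (∏ k ∈ s, f k) = ∑ k ∈ s, ∏ l ∈ s, if l = k then D (f l) else f l := by
  induction s using Finset.induction_on with
  | empty => simp
  | insert a s ha ih =>
    rw [Finset.prod_insert ha, leibniz, ih, Finset.sum_insert ha, Finset.prod_insert ha]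
    have h1 : (∏ l ∈ s, if l = a then D (f l) else f l) = ∏ l ∈ s, f l :=
      Finset.prod_congr rfl fun l hl => if_neg (by rintro rfl; exact ha hl)
    have h2 : ∀ k ∈ s, (∏ l ∈ insert a s, if l = k then D (f l) else f l) =
        f a * ∏ l ∈ s, if l = k then D (f l) else f l := fun k hk => by
      rw [Finset.prod_insert ha, if_neg (by rintro rfl; exact ha hk)]
    rw [h1, Finset.sum_congr rfl h2, if_pos rfl, ← Finset.mul_sum, smul_eq_mul, smul_eq_mul]
    ring

/-- Jacobi's formula for the derivative of a determinant. -/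
theorem map_det (D : Derivation R A A) (M : Matrix ι ι A) :
    D M.det = ∑ i, ∑ j, D (M i j) * M.adjugate j i := by
  have h : ∀ i, ∑ j, D (M i j) * M.adjugate j i = (M.updateRow i fun j => D (M i j)).det :=
    fun i => (Matrix.det_updateRow_eq_sum M i _).symm
  simp only [h]
  -- After transposition the products in the Leibniz expansion are indexed by rows, so
  -- differentiating the factor `i` is the same as updating row `i`.
  simp only [← Matrix.det_transpose M, ← Matrix.det_transpose (Matrix.updateRow M _ _),
    Matrix.det_apply', Matrix.transpose_apply, map_sum]
  rw [Finset.sum_comm]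
  refine Finset.sum_congr rfl fun σ _ => ?_
  rw [← Finset.mul_sum, leibniz, map_intCast, smul_zero, add_zero, smul_eq_mul, map_finset_prod]
  congr 1
  refine Finset.sum_congr rfl fun i _ => Finset.prod_congr rfl fun l _ => ?_
  simp only [Matrix.updateRow_apply]
  split_ifs with hl
  · rw [hl]
  · rfl

/-- The derivative of the adjugate, multiplied by the determinant. -/
theorem det_mul_map_adjugate (D : Derivation R A A) (M : Matrix ι ι A) (k l : ι) :
    M.det * D (M.adjugate k l) = ∑ i, ∑ j, D (M i j) *
      (M.adjugate j i * M.adjugate k l - M.adjugate k i * M.adjugate j l) := by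
  -- Differentiate `adj M * M = det M • 1`, then multiply by `adj M` on the right to isolate `det M
  -- * D (adj M)`.
  have h1 : ∀ j, ∑ i, M.adjugate k i * D (M i j) + ∑ i, D (M.adjugate k i) * M i j =
      D M.det * (1 : Matrix ι ι A) k j := fun j => by
    have := congrArg D (congrFun (congrFun (Matrix.adjugate_mul M) k) j)
    rw [Matrix.mul_apply, map_sum, Matrix.smul_apply, smul_eq_mul, leibniz] at this
    have h0 : D ((1 : Matrix ι ι A) k j) = 0 := by
      rw [Matrix.one_apply]; split_ifs <;> simp
    rw [h0, smul_zero, zero_add, smul_eq_mul, mul_comm] at this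
    rw [← this, ← Finset.sum_add_distrib]
    refine Finset.sum_congr rfl fun i _ => ?_
    rw [leibniz, smul_eq_mul, smul_eq_mul, mul_comm (M i j)]
  have h2 : ∑ j, (∑ i, D (M.adjugate k i) * M i j) * M.adjugate j l =
      M.det * D (M.adjugate k l) := by
    have h3 : ∀ i, ∑ j, M i j * M.adjugate j l = M.det * (1 : Matrix ι ι A) i l := fun i => by
      rw [← Matrix.mul_apply, Matrix.mul_adjugate, Matrix.smul_apply, smul_eq_mul]
    simp only [Finset.sum_mul]
    rw [Finset.sum_comm]
    simp only [mul_assoc, ← Finset.mul_sum, h3, Matrix.one_apply]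
    simp [mul_comm]
  rw [← h2]
  have h4 : ∀ j, ∑ i, D (M.adjugate k i) * M i j =
      D M.det * (1 : Matrix ι ι A) k j - ∑ i, M.adjugate k i * D (M i j) := fun j => by
    rw [← h1 j]; ring
  simp only [h4, sub_mul, Finset.sum_sub_distrib, mul_sub]
  congr 1
  · simp only [Matrix.one_apply, mul_ite, mul_one, mul_zero, ite_mul, zero_mul, Finset.sum_ite_eq,
      Finset.mem_univ, if_true, map_det, Finset.sum_mul, mul_assoc]
  · rw [Finset.sum_comm]
    refine Finset.sum_congr rfl fun j _ => ?_
    rw [Finset.sum_mul]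
    exact Finset.sum_congr rfl fun i _ => by ring

/-- The extension of a derivation to polynomials, acting on the coefficients. -/
def onPolynomial (D : Derivation R A A) : Derivation R (Polynomial A) (Polynomial A) :=
  (PolynomialModule.equivPolynomialSelf (R := A)).toLinearMap.compDer D.mapCoeffs

theorem coeff_onPolynomial (D : Derivation R A A) (p : Polynomial A) (n : ℕ) :
    (D.onPolynomial p).coeff n = D (p.coeff n) := rfl

theorem onPolynomial_C (D : Derivation R A A) (a : A) :
    D.onPolynomial (Polynomial.C a) = Polynomial.C (D a) := by
  ext n
  rw [coeff_onPolynomial, Polynomial.coeff_C, Polynomial.coeff_C]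
  split_ifs <;> simp

theorem onPolynomial_X (D : Derivation R A A) : D.onPolynomial Polynomial.X = 0 := by
  ext n
  rw [coeff_onPolynomial, Polynomial.coeff_X]
  split_ifs <;> simp

end Derivation

/-! ### The divergence of a column of the adjugate. -/

namespace Matrix

variable {R ι A : Type*} [Fintype ι] [DecidableEq ι] [CommRing R] [CommRing A] [Algebra R A]

/-- The factor `det M` makes the derivative of the adjugate quadratic in cofactors. The terms with
`c i j` then pair an antisymmetric factor with a symmetric one and cancel; the terms with `b`
collapse through `adj M * M = det M • 1`. -/
theorem det_mul_sum_derivation_adjugate {M : Matrix ι ι A} (hM : M.IsSymm)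
    (δ : ι → Derivation R A A) (u : ι → A) (c : ι → ι → A) (b : A)
    (hc : ∀ i j, i ≠ j → c i j = -c j i)
    (h0 : ∀ i j k, j ≠ i → k ≠ i → j ≠ k → δ i (M j k) = 0)
    (h1 : ∀ i j, j ≠ i → δ i (M i j) = c i j * M i j)
    (h2 : ∀ i j, j ≠ i → u i * δ i (M j j) = -((c i j - b) * M i j * u j)) (k : ι) :
    M.det * (∑ i, u i * δ i (M.adjugate k i) + b * ∑ i, u i * M.adjugate k i -
      b * (u k * M.adjugate k k)) = 0 := by
  have hMs : ∀ i j, M j i = M i j := fun i j => hM.apply i j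
  have hGs : ∀ i j, M.adjugate j i = M.adjugate i j := fun i j => hM.adjugate.apply i j
  have hGM : ∀ i j, ∑ l, M.adjugate i l * M l j = M.det * (1 : Matrix ι ι A) i j := fun i j => by
    rw [← Matrix.mul_apply, Matrix.adjugate_mul, Matrix.smul_apply, smul_eq_mul]
  set G := M.adjugate with hG
  -- `B` collects what multiplies `c i j * M i j`: the first bracket comes from the entry `(j, i)`,
  -- the second from the diagonal entry `(j, j)`. It is symmetric in `i, j` because the adjugate is.
  -- `T` collects what multiplies `b`.
  let B : ι → ι → A := fun i j =>
    u i * (G i j * G k i - G k j * G i i) - u j * (G j j * G k i - G k j * G j i)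
  let T : ι → ι → A := fun i j => M i j * (u j * (G j j * G k i - G k j * G j i))
  have key : ∀ i, M.det * (u i * δ i (G k i)) =
      ∑ j, ((if i = j then 0 else c i j * M i j * B i j) + b * T i j) := by
    intro i
    rw [mul_left_comm, hG, Derivation.det_mul_map_adjugate, ← hG, Finset.mul_sum]
    refine Finset.sum_congr rfl fun j _ => ?_
    rcases eq_or_ne i j with rfl | hij
    · rw [if_pos rfl, Finset.sum_eq_zero fun l _ => by ring]
      simp only [T]
      ring
    · rw [if_neg hij, ← Finset.add_sum_erase _ _ (Finset.mem_univ i),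
        ← Finset.add_sum_erase _ _ (Finset.mem_erase.2 ⟨hij.symm, Finset.mem_univ j⟩),
        Finset.sum_eq_zero]
      · rw [hMs i j, h1 i j hij.symm]
        have := h2 i j hij.symm
        simp only [B, T]
        linear_combination (G j j * G k i - G k j * G j i) * this
      · intro l hl
        simp only [Finset.mem_erase, Finset.mem_univ, and_true] at hl
        rw [h0 i j l hij.symm hl.2 hl.1.symm, zero_mul]
  have hB : ∑ i, ∑ j, (if i = j then 0 else c i j * M i j * B i j) = 0 := by
    rw [← Finset.sum_product']
    refine Finset.sum_involution (fun p _ => p.swap) ?_ ?_ (fun _ _ => Finset.mem_univ _)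
      (fun _ _ => Prod.swap_swap _)
    · rintro ⟨i, j⟩ -
      rcases eq_or_ne i j with rfl | hij
      · simp
      · simp only [Prod.fst_swap, Prod.snd_swap, if_neg hij, if_neg hij.symm, hMs i j,
          hc i j hij, B, hGs i j]
        ring
    · rintro ⟨i, j⟩ - h h'
      simp only [Prod.swap_prod_mk, Prod.mk.injEq] at h'
      exact h (if_pos h'.2)
  have hT : ∑ i, ∑ j, b * T i j =
      M.det * (b * (u k * G k k) - b * ∑ i, u i * G k i) := by
    rw [Finset.sum_comm]
    have : ∀ j, ∑ i, b * T i j =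
        M.det * (b * (u j * G j j) * (1 : Matrix ι ι A) k j - b * (u j * G k j)) := by
      intro j
      calc ∑ i, b * T i j = b * u j * (G j j * (∑ i, G k i * M i j) -
            G k j * ∑ i, G j i * M i j) := by
            rw [Finset.mul_sum, Finset.mul_sum, ← Finset.sum_sub_distrib, Finset.mul_sum]
            exact Finset.sum_congr rfl fun i _ => by simp only [T]; ring
        _ = _ := by rw [hGM, hGM, one_apply_eq]; ring
    simp only [this]
    rw [← Finset.mul_sum, Finset.sum_sub_distrib, ← Finset.mul_sum]
    simp [Matrix.one_apply]
  have : ∑ i, M.det * (u i * δ i (G k i)) =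
      M.det * (b * (u k * G k k) - b * ∑ i, u i * G k i) := by
    simp only [key, Finset.sum_add_distrib, hB, hT, zero_add]
  rw [← Finset.mul_sum] at this
  linear_combination this

/-- A divergence formula for the adjugate of a symmetric matrix: `δ i` acts on the row and the
column `i` by scaling factors `c i j` that are antisymmetric, and on the diagonal in a
compensating way. -/
theorem sum_derivation_adjugate {M : Matrix ι ι A} (hM : M.IsSymm)
    (δ : ι → Derivation R A A) (u : ι → A) (c : ι → ι → A) (b : A)
    (hc : ∀ i j, i ≠ j → c i j = -c j i)
    (h0 : ∀ i j k, j ≠ i → k ≠ i → j ≠ k → δ i (M j k) = 0)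
    (h1 : ∀ i j, j ≠ i → δ i (M i j) = c i j * M i j)
    (h2 : ∀ i j, j ≠ i → u i * δ i (M j j) = -((c i j - b) * M i j * u j)) (k : ι) :
    ∑ i, u i * δ i (M.adjugate k i) + b * ∑ i, u i * M.adjugate k i =
      b * (u k * M.adjugate k k) := by
  -- To cancel the determinant, which may be a zero divisor, `M` is deformed to `X • 1 + M`, the
  -- characteristic matrix of `-M`. The derivations act on coefficients and kill `X`, so the
  -- hypotheses persist; the determinant becomes monic, hence regular. The constant coefficient
  -- gives the claim for `M`.
  have hoff : ∀ i j, i ≠ j → (-M).charmatrix i j = Polynomial.C (M i j) := fun i j h => by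
    rw [charmatrix_apply_ne _ _ _ h, neg_apply, map_neg, neg_neg]
  have hdiag : ∀ i, (-M).charmatrix i i = Polynomial.X + Polynomial.C (M i i) := fun i => by
    rw [charmatrix_apply_eq, neg_apply, map_neg, sub_neg_eq_add]
  have hsymm : ((-M).charmatrix).IsSymm := by
    rw [IsSymm, ← charmatrix_transpose, transpose_neg, hM.eq]
  have key := det_mul_sum_derivation_adjugate hsymm (fun i => (δ i).onPolynomial)
    (fun i => Polynomial.C (u i)) (fun i j => Polynomial.C (c i j)) (Polynomial.C b)
    (fun i j h => by rw [hc i j h, map_neg])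
    (fun i j k hj hk hjk => by
      rw [hoff j k hjk, Derivation.onPolynomial_C, h0 i j k hj hk hjk, map_zero])
    (fun i j hj => by
      rw [hoff i j hj.symm, Derivation.onPolynomial_C, h1 i j hj, map_mul])
    (fun i j hj => by
      rw [hdiag, hoff i j hj.symm, map_add, Derivation.onPolynomial_C, Derivation.onPolynomial_X,
        zero_add, ← map_mul, h2 i j hj]
      simp only [map_neg, map_mul, map_sub]) k
  have hreg := ((-M).charpoly_monic.mem_nonZeroDivisors).1 _ key
  have hev : ((-M).charmatrix).map (Polynomial.evalRingHom 0) = M := by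
    ext i j
    rcases eq_or_ne i j with rfl | h
    · simp
    · simp [hoff i j h]
  have hadj : ∀ i j, ((-M).charmatrix.adjugate i j).coeff 0 = M.adjugate i j := fun i j => by
    rw [Polynomial.coeff_zero_eq_eval_zero, ← Polynomial.coe_evalRingHom]
    conv_rhs => rw [← hev, ← RingHom.mapMatrix_apply, ← RingHom.map_adjugate]
    rfl
  have hco := congrArg (fun p => Polynomial.coeff p 0) hreg
  simp only [Polynomial.coeff_sub, Polynomial.coeff_add, Polynomial.finsetSum_coeff,
    Polynomial.coeff_C_mul, Derivation.coeff_onPolynomial, hadj, Polynomial.coeff_zero] at hco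
  exact sub_eq_zero.1 hco

end Matrix

namespace MHV

variable {m : ℕ} {τ : Fin 2 → Fin 2 → ℂ} {ξ : Fin 2 → ℂ}

/-! ### The commutative ring of even integrands -/

/-- A copy of `Even`, whose ring structure does not unfold to that of the tensor product. -/
def EvenRing (m : ℕ) (τ : Fin 2 → Fin 2 → ℂ) (ξ : Fin 2 → ℂ) : Type := Even m τ ξ

instance : CommRing (EvenRing m τ ξ) := inferInstanceAs (CommRing (Even m τ ξ))

instance : Algebra ℂ (EvenRing m τ ξ) := inferInstanceAs (Algebra ℂ (Even m τ ξ))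

/-- The inclusion into the algebra of integrands. -/
def incl : EvenRing m τ ξ →ₐ[ℂ] Integrand m τ ξ := (Subalgebra.center ℂ (Integrand m τ ξ)).val

theorem incl_injective : Function.Injective (incl (m := m) (τ := τ) (ξ := ξ)) :=
  Subtype.val_injective

/-- `ev` as a homomorphism of algebras. -/
def evE : EvenFun m τ ξ →ₐ[ℂ] EvenRing m τ ξ where
  toFun := ev
  map_one' := rfl
  map_mul' f g := Subtype.ext (by
    change (f * g) ⊗ₜ[ℂ] (1 : Grass m) = (f ⊗ₜ[ℂ] 1) * (g ⊗ₜ[ℂ] 1)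
    rw [Algebra.TensorProduct.tmul_mul_tmul, one_mul])
  map_zero' := Subtype.ext (TensorProduct.zero_tmul _ _)
  map_add' f g := Subtype.ext (TensorProduct.add_tmul _ _ _)
  commutes' c := rfl

/-- `oddProd` with values in `EvenRing`. -/
def oddProdE (u v : OddVar m) : EvenRing m τ ξ := oddProd u v

theorem incl_evE (f : EvenFun m τ ξ) : incl (evE f) = f ⊗ₜ[ℂ] 1 := rfl

theorem incl_comm (z : EvenRing m τ ξ) (F : Integrand m τ ξ) : F * incl z = incl z * F :=
  Subalgebra.mem_center_iff.1 z.2 F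

theorem rTensor_derivation_mul (D : Derivation ℂ (EvenFun m τ ξ) (EvenFun m τ ξ))
    (F G : Integrand m τ ξ) :
    LinearMap.rTensor (Grass m) D.toLinearMap (F * G) =
      LinearMap.rTensor (Grass m) D.toLinearMap F * G +
        F * LinearMap.rTensor (Grass m) D.toLinearMap G := by
  induction F using TensorProduct.induction_on with
  | zero => simp
  | add x y hx hy => simp only [add_mul, map_add, hx, hy]; abel
  | tmul f g =>
    induction G using TensorProduct.induction_on with
    | zero => simp
    | add x y hx hy => simp only [mul_add, map_add, hx, hy]; abel
    | tmul f' g' =>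
      simp only [Algebra.TensorProduct.tmul_mul_tmul, LinearMap.rTensor_tmul,
        Derivation.coeFn_coe, Derivation.leibniz, smul_eq_mul, TensorProduct.add_tmul]
      rw [add_comm, mul_comm f']

theorem odd_anticomm (u v : OddVar m) : odd m u * odd m v = -(odd m v * odd m u) :=
  eq_neg_of_add_eq_zero_left (ExteriorAlgebra.ι_add_mul_swap _ _)

theorem contractLeft_odd_mul (a : Fin 4) (A : Fin 2) (u : OddVar m) (g : Grass m) :
    CliffordAlgebra.contractLeft (Q := (0 : QuadraticForm ℂ (OddVar m →₀ ℂ)))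
        (Finsupp.lapply (OddVar.X a A)) (odd m u * g) =
      (Finsupp.single u (1 : ℂ) (OddVar.X a A)) • g - odd m u *
        CliffordAlgebra.contractLeft (Q := (0 : QuadraticForm ℂ (OddVar m →₀ ℂ)))
          (Finsupp.lapply (OddVar.X a A)) g :=
  CliffordAlgebra.contractLeft_ι_mul (Q := (0 : QuadraticForm ℂ (OddVar m →₀ ℂ))) _ _ _

/-- An odd variable as an integrand. -/
def oddElt (u : OddVar m) : Integrand m τ ξ := 1 ⊗ₜ[ℂ] odd m u

theorem incl_oddProdE (u v : OddVar m) :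
    incl (oddProdE u v : EvenRing m τ ξ) = oddElt u * oddElt v := by
  rw [oddElt, oddElt, Algebra.TensorProduct.tmul_mul_tmul, one_mul]; rfl

theorem oddElt_anticomm (u v : OddVar m) :
    (oddElt u * oddElt v : Integrand m τ ξ) = -(oddElt v * oddElt u) := by
  rw [oddElt, oddElt, Algebra.TensorProduct.tmul_mul_tmul, Algebra.TensorProduct.tmul_mul_tmul,
    odd_anticomm, TensorProduct.tmul_neg]

theorem oddProdE_anticomm (u v : OddVar m) : (oddProdE u v : EvenRing m τ ξ) = -oddProdE v u :=
  incl_injective (by rw [map_neg, incl_oddProdE, incl_oddProdE, oddElt_anticomm])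

theorem partialDer_odd_oddElt_mul (a : Fin 4) (A : Fin 2) (u : OddVar m) (F : Integrand m τ ξ) :
    partialDer m τ ξ (IntVar.odd a A) (oddElt u * F) =
      (Finsupp.single u (1 : ℂ) (OddVar.X a A)) • F -
        oddElt u * partialDer m τ ξ (IntVar.odd a A) F := by
  induction F using TensorProduct.induction_on with
  | zero => simp
  | add x y hx hy => simp only [mul_add, map_add, hx, hy, smul_add]; abel
  | tmul f g =>
    simp only [oddElt, partialDer, Algebra.TensorProduct.tmul_mul_tmul, one_mul,
      LinearMap.lTensor_tmul, contractLeft_odd_mul, TensorProduct.tmul_sub,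
      TensorProduct.tmul_smul]

theorem partialDer_odd_evE_mul (a : Fin 4) (A : Fin 2) (f : EvenFun m τ ξ)
    (F : Integrand m τ ξ) :
    partialDer m τ ξ (IntVar.odd a A) (incl (evE f) * F) =
      incl (evE f) * partialDer m τ ξ (IntVar.odd a A) F := by
  induction F using TensorProduct.induction_on with
  | zero => simp
  | add x y hx hy => simp only [mul_add, map_add, hx, hy]
  | tmul f' g =>
    simp only [incl_evE, partialDer, Algebra.TensorProduct.tmul_mul_tmul, one_mul,
      LinearMap.lTensor_tmul]

theorem partialDer_odd_one (a : Fin 4) (A : Fin 2) :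
    partialDer m τ ξ (IntVar.odd a A) 1 = 0 := by
  change (1 : EvenFun m τ ξ) ⊗ₜ[ℂ] (CliffordAlgebra.contractLeft
    (Q := (0 : QuadraticForm ℂ (OddVar m →₀ ℂ))) (Finsupp.lapply (OddVar.X a A)) 1) = 0
  rw [CliffordAlgebra.contractLeft_one, TensorProduct.tmul_zero]

theorem partialDer_one (v : IntVar m) : partialDer m τ ξ v 1 = 0 := by
  cases v with
  | odd a A => exact partialDer_odd_one a A
  | even α A =>
    have := rTensor_derivation_mul (evenDer m τ ξ (EvenVar.X α A)) (1 : Integrand m τ ξ) 1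
    rw [mul_one, mul_one, one_mul, left_eq_add] at this
    exact this
  | sig i A =>
    have := rTensor_derivation_mul (evenDer m τ ξ (EvenVar.sig i A)) (1 : Integrand m τ ξ) 1
    rw [mul_one, mul_one, one_mul, left_eq_add] at this
    exact this

/-- The even integrands that obey the Leibniz rule for all the partial derivatives. -/
def leibnizSubalgebra (m : ℕ) (τ : Fin 2 → Fin 2 → ℂ) (ξ : Fin 2 → ℂ) :
    Subalgebra ℂ (EvenRing m τ ξ) where
  carrier := {z | ∀ (v : IntVar m) (F : Integrand m τ ξ), partialDer m τ ξ v (incl z * F) =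
    partialDer m τ ξ v (incl z) * F + incl z * partialDer m τ ξ v F}
  add_mem' {x y} hx hy v F := by
    rw [map_add, add_mul, map_add, hx v F, hy v F, map_add, add_mul, add_mul]
    abel
  mul_mem' {x y} hx hy v F := by
    rw [map_mul incl, mul_assoc, hx v (incl y * F), hy v F, hx v (incl y)]
    noncomm_ring
  algebraMap_mem' c v F := by
    rw [AlgHom.commutes, Algebra.algebraMap_eq_smul_one, smul_one_mul, map_smul, map_smul,
      partialDer_one, smul_zero, zero_mul, zero_add, smul_one_mul]

theorem leibniz_of_mem {z : EvenRing m τ ξ} (hz : z ∈ leibnizSubalgebra m τ ξ) (v : IntVar m)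
    (F : Integrand m τ ξ) : partialDer m τ ξ v (incl z * F) =
      partialDer m τ ξ v (incl z) * F + incl z * partialDer m τ ξ v F :=
  hz v F

theorem partialDer_odd_evE (a : Fin 4) (A : Fin 2) (f : EvenFun m τ ξ) :
    partialDer m τ ξ (IntVar.odd a A) (incl (evE f)) = 0 := by
  have := partialDer_odd_evE_mul a A f 1
  rwa [mul_one, partialDer_one, mul_zero] at this

theorem partialDer_even_evE (α : Fin 4) (A : Fin 2) (f : EvenFun m τ ξ) :
    partialDer m τ ξ (IntVar.even α A) (incl (evE f)) =
      incl (evE (evenDer m τ ξ (EvenVar.X α A) f)) := rfl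

theorem partialDer_sig_evE (i : Fin m) (A : Fin 2) (f : EvenFun m τ ξ) :
    partialDer m τ ξ (IntVar.sig i A) (incl (evE f)) =
      incl (evE (evenDer m τ ξ (EvenVar.sig i A) f)) := rfl

theorem partialDer_odd_oddProdE (a : Fin 4) (A : Fin 2) (u v : OddVar m) :
    partialDer m τ ξ (IntVar.odd a A) (incl (oddProdE u v)) =
      (Finsupp.single u (1 : ℂ) (OddVar.X a A)) • oddElt v -
        (Finsupp.single v (1 : ℂ) (OddVar.X a A)) • oddElt u := by
  have h := partialDer_odd_oddElt_mul (τ := τ) (ξ := ξ) a A v 1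
  rw [mul_one, partialDer_one, mul_zero, sub_zero] at h
  rw [incl_oddProdE, partialDer_odd_oddElt_mul, h, mul_smul_one]

theorem partialDer_even_oddProdE (α : Fin 4) (A : Fin 2) (u v : OddVar m) :
    partialDer m τ ξ (IntVar.even α A) (incl (oddProdE u v)) = 0 := by
  change (evenDer m τ ξ _ 1) ⊗ₜ[ℂ] (odd m u * odd m v) = 0
  rw [Derivation.map_one_eq_zero, TensorProduct.zero_tmul]

theorem partialDer_sig_oddProdE (i : Fin m) (A : Fin 2) (u v : OddVar m) :
    partialDer m τ ξ (IntVar.sig i A) (incl (oddProdE u v)) = 0 := by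
  change (evenDer m τ ξ _ 1) ⊗ₜ[ℂ] (odd m u * odd m v) = 0
  rw [Derivation.map_one_eq_zero, TensorProduct.zero_tmul]

theorem evE_mem_leibniz (f : EvenFun m τ ξ) : evE f ∈ leibnizSubalgebra m τ ξ := by
  rintro (⟨α, A⟩ | ⟨a, A⟩ | ⟨i, A⟩) F
  · exact rTensor_derivation_mul _ _ _
  · rw [partialDer_odd_evE_mul, partialDer_odd_evE, zero_mul, zero_add]
  · exact rTensor_derivation_mul _ _ _

/-- An odd derivative is an antiderivation; passing it through two odd factors produces two signs,
which cancel. -/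
theorem oddProdE_mem_leibniz (u v : OddVar m) : oddProdE u v ∈ leibnizSubalgebra m τ ξ := by
  rintro (⟨α, A⟩ | ⟨a, A⟩ | ⟨i, A⟩) F
  · exact rTensor_derivation_mul _ _ _
  · rw [partialDer_odd_oddProdE, incl_oddProdE, mul_assoc, partialDer_odd_oddElt_mul,
      partialDer_odd_oddElt_mul, mul_sub, sub_mul, smul_mul_assoc, smul_mul_assoc, mul_smul_comm]
    noncomm_ring
  · exact rTensor_derivation_mul _ _ _

/-- The even integrands that do not depend on `X`. -/
def xFree (m : ℕ) (τ : Fin 2 → Fin 2 → ℂ) (ξ : Fin 2 → ℂ) : Subalgebra ℂ (EvenRing m τ ξ) where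
  carrier := {z | z ∈ leibnizSubalgebra m τ ξ ∧
    (∀ α A, partialDer m τ ξ (IntVar.even α A) (incl z) = 0) ∧
    ∀ a A, partialDer m τ ξ (IntVar.odd a A) (incl z) = 0}
  add_mem' {x y} hx hy := by
    refine ⟨add_mem hx.1 hy.1, fun α A => ?_, fun a A => ?_⟩ <;> rw [map_add, map_add]
    · rw [hx.2.1, hy.2.1, add_zero]
    · rw [hx.2.2, hy.2.2, add_zero]
  mul_mem' {x y} hx hy := by
    refine ⟨mul_mem hx.1 hy.1, fun α A => ?_, fun a A => ?_⟩ <;>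
      rw [map_mul incl, leibniz_of_mem hx.1]
    · rw [hx.2.1, hy.2.1, zero_mul, mul_zero, add_zero]
    · rw [hx.2.2, hy.2.2, zero_mul, mul_zero, add_zero]
  algebraMap_mem' c := by
    refine ⟨Subalgebra.algebraMap_mem _ c, fun α A => ?_, fun a A => ?_⟩ <;>
      rw [AlgHom.commutes, Algebra.algebraMap_eq_smul_one, map_smul, partialDer_one, smul_zero]

theorem partialDer_sig_mul (i : Fin m) (A : Fin 2) (F G : Integrand m τ ξ) :
    partialDer m τ ξ (IntVar.sig i A) (F * G) =
      partialDer m τ ξ (IntVar.sig i A) F * G + F * partialDer m τ ξ (IntVar.sig i A) G :=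
  rTensor_derivation_mul (evenDer m τ ξ (EvenVar.sig i A)) F G

/-- Differentiating `F z = z F` and cancelling the terms with the derivative of `F` shows that the
derivative of `z` commutes with `F`. -/
theorem partialDer_sig_mem_center (i : Fin m) (A : Fin 2) (z : EvenRing m τ ξ) :
    partialDer m τ ξ (IntVar.sig i A) (incl z) ∈ Subalgebra.center ℂ (Integrand m τ ξ) := by
  rw [Subalgebra.mem_center_iff]
  intro F
  have h1 := partialDer_sig_mul i A F (incl z)
  rw [incl_comm z F, partialDer_sig_mul, incl_comm z, add_comm] at h1
  exact (add_left_cancel h1).symm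

/-- The derivative with respect to a component of `σᵢ`, as a derivation of `EvenRing`. -/
def sigDer (i : Fin m) (A : Fin 2) : Derivation ℂ (EvenRing m τ ξ) (EvenRing m τ ξ) :=
  Derivation.mk'
    { toFun := fun z => ⟨partialDer m τ ξ (IntVar.sig i A) (incl z),
        partialDer_sig_mem_center i A z⟩
      map_add' := fun x y => Subtype.ext (map_add (partialDer m τ ξ (IntVar.sig i A)) _ _)
      map_smul' := fun c x => Subtype.ext (map_smul (partialDer m τ ξ (IntVar.sig i A)) c _) }
    (fun x y => Subtype.ext (by
      have h := partialDer_sig_mul i A (incl x) (incl y)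
      rw [incl_comm y (partialDer m τ ξ (IntVar.sig i A) (incl x)), add_comm] at h
      exact h))

theorem incl_sigDer (i : Fin m) (A : Fin 2) (z : EvenRing m τ ξ) :
    incl (sigDer i A z) = partialDer m τ ξ (IntVar.sig i A) (incl z) := rfl

theorem sigDer_evE (i : Fin m) (A : Fin 2) (f : EvenFun m τ ξ) :
    sigDer i A (evE f) = evE (evenDer m τ ξ (EvenVar.sig i A) f) := rfl

theorem sigDer_oddProdE (i : Fin m) (A : Fin 2) (u v : OddVar m) :
    sigDer i A (oddProdE u v : EvenRing m τ ξ) = 0 :=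
  incl_injective (by rw [incl_sigDer, partialDer_sig_oddProdE, map_zero])

/-! ### Derivatives of the basic functions -/

theorem evenDer_algebraMap (v : EvenVar m) (p : MvPolynomial (EvenVar m) ℂ) :
    evenDer m τ ξ v (algebraMap _ (EvenFun m τ ξ) p) =
      algebraMap _ (EvenFun m τ ξ) (MvPolynomial.pderiv v p) :=
  locDer_algebraMap _ _ _

open Classical in
theorem evenDer_evar (v w : EvenVar m) :
    evenDer m τ ξ v (evar w) = if w = v then 1 else 0 := by
  rw [evar, evenDer_algebraMap, MvPolynomial.pderiv_X, Pi.single_apply]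
  split_ifs <;> simp_all

theorem evenDer_evar_of_ne {v w : EvenVar m} (h : w ≠ v) : evenDer m τ ξ v (evar w) = 0 := by
  rw [evenDer_evar, if_neg h]

theorem sig_inr (i : Fin m) (A : Fin 2) :
    (sig (Sum.inr i) A : EvenFun m τ ξ) = evar (EvenVar.sig i A) := rfl

theorem sig_inl (a : Fin 2) (A : Fin 2) :
    (sig (Sum.inl a) A : EvenFun m τ ξ) = cst (τ a) A := by
  rw [sig, sigPoly, cst, IsScalarTower.algebraMap_apply ℂ (MvPolynomial (EvenVar m) ℂ)]; rfl

theorem evenDer_cst (v : EvenVar m) (ζ : Fin 2 → ℂ) (A : Fin 2) :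
    evenDer m τ ξ v (cst ζ A) = 0 :=
  Derivation.map_algebraMap _ _

theorem evenDer_X_sig (α : Fin 4) (A : Fin 2) (i : Particle m) (B : Fin 2) :
    evenDer m τ ξ (EvenVar.X α A) (sig i B) = 0 := by
  rcases i with a | i
  · rw [sig_inl, evenDer_cst]
  · rw [sig_inr, evenDer_evar_of_ne (by simp)]

/-- The functions that do not depend on `X`. -/
def xFreeFun (m : ℕ) (τ : Fin 2 → Fin 2 → ℂ) (ξ : Fin 2 → ℂ) : Subalgebra ℂ (EvenFun m τ ξ) where
  carrier := {f | ∀ α A, evenDer m τ ξ (EvenVar.X α A) f = 0}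
  add_mem' hx hy α A := by rw [map_add, hx α A, hy α A, add_zero]
  mul_mem' hx hy α A := by rw [Derivation.leibniz, hx α A, hy α A, smul_zero, smul_zero, add_zero]
  algebraMap_mem' c α A := Derivation.map_algebraMap _ _

theorem ringInverse_mem_xFreeFun {f : EvenFun m τ ξ} (hf : f ∈ xFreeFun m τ ξ) :
    Ring.inverse f ∈ xFreeFun m τ ξ := by
  by_cases h : IsUnit f
  · intro α A
    rw [Derivation.leibniz_of_mul_eq_one _ (Ring.inverse_mul_cancel f h), hf α A, smul_zero]
  · rw [Ring.inverse_non_unit f h]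
    exact zero_mem _

theorem sig_mem_xFreeFun (i : Particle m) (A : Fin 2) : sig i A ∈ xFreeFun m τ ξ :=
  fun α B => evenDer_X_sig α B i A

theorem cst_mem_xFreeFun (ζ : Fin 2 → ℂ) (A : Fin 2) : cst ζ A ∈ xFreeFun m τ ξ :=
  fun _ _ => evenDer_cst _ _ _

theorem br_mem_xFreeFun {u v : Fin 2 → EvenFun m τ ξ} (hu : ∀ A, u A ∈ xFreeFun m τ ξ)
    (hv : ∀ A, v A ∈ xFreeFun m τ ξ) : br u v ∈ xFreeFun m τ ξ :=
  sub_mem (mul_mem (hu 0) (hv 1)) (mul_mem (hu 1) (hv 0))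

theorem sbr_mem_xFreeFun (i j : Particle m) : sbr i j ∈ xFreeFun m τ ξ :=
  br_mem_xFreeFun (sig_mem_xFreeFun i) (sig_mem_xFreeFun j)

theorem rbr_mem_xFreeFun (ζ : Fin 2 → ℂ) (j : Particle m) : rbr ζ j ∈ xFreeFun m τ ξ :=
  br_mem_xFreeFun (cst_mem_xFreeFun ζ) (sig_mem_xFreeFun j)

theorem evar_W_mem_xFreeFun (i : Particle m) (α : Fin 4) :
    evar (EvenVar.W i α) ∈ xFreeFun m τ ξ :=
  fun _ _ => evenDer_evar_of_ne (by simp)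

theorem evE_mem_xFree {f : EvenFun m τ ξ} (hf : f ∈ xFreeFun m τ ξ) : evE f ∈ xFree m τ ξ :=
  ⟨evE_mem_leibniz f, fun α A => by rw [partialDer_even_evE, hf α A, map_zero, map_zero],
    fun a A => partialDer_odd_evE a A f⟩

theorem oddProdE_W_mem_xFree (i j : Particle m) (a b : Fin 4) :
    oddProdE (OddVar.W i a) (OddVar.W j b) ∈ xFree m τ ξ :=
  ⟨oddProdE_mem_leibniz _ _, fun α A => partialDer_even_oddProdE α A _ _,
    fun a A => by rw [partialDer_odd_oddProdE]; simp⟩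

/-- `wbr` with values in `EvenRing`. -/
def wbrE (s : ℂ) (i j : Particle m) : EvenRing m τ ξ := wbr s i j

theorem wbrE_eq (s : ℂ) (i j : Particle m) : (wbrE s i j : EvenRing m τ ξ) =
    (∑ α : Fin 4, ∑ β : Fin 4, infUpper (s ^ 2) α β •
      evE (evar (EvenVar.W i α) * evar (EvenVar.W j β))) -
    s • ∑ a : Fin 4, oddProdE (OddVar.W i a) (OddVar.W j a) := by rfl

/-- `xsq` with values in `EvenRing`. -/
def xsqE (s : ℂ) : EvenRing m τ ξ := xsq s

theorem xsqE_eq (s : ℂ) : (xsqE s : EvenRing m τ ξ) =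
    (∑ α : Fin 4, ∑ β : Fin 4, infLower (s ^ 2) α β •
      evE (evar (EvenVar.X α 0) * evar (EvenVar.X β 1))) +
    s • ∑ a : Fin 4, oddProdE (OddVar.X a 0) (OddVar.X a 1) := by rfl

/-- `hodgesOff` with values in `EvenRing`. -/
def hodgesOffE (s : ℂ) (i j : Particle m) : EvenRing m τ ξ := hodgesOff s i j

theorem hodgesOffE_eq (s : ℂ) (i j : Particle m) : (hodgesOffE s i j : EvenRing m τ ξ) =
    -(wbrE s i j * evE (Ring.inverse (sbr i j))) := by rfl

/-- `hodges` with values in `EvenRing`. -/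
def hodgesE (s : ℂ) (ζ : Fin 2 → ℂ) : Matrix (Particle m) (Particle m) (EvenRing m τ ξ) :=
  hodges s ζ

theorem hodgesE_apply (s : ℂ) (ζ : Fin 2 → ℂ) (i j : Particle m) :
    (hodgesE s ζ i j : EvenRing m τ ξ) = if i = j then
      -∑ k ∈ Finset.univ.erase i,
        hodgesOffE s i k * evE (rbr ζ k ^ 2 * Ring.inverse (rbr ζ i) ^ 2)
    else hodgesOffE s i j := by rfl

theorem wbrE_mem_xFree (s : ℂ) (i j : Particle m) : wbrE s i j ∈ xFree m τ ξ := by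
  rw [wbrE_eq]
  exact sub_mem (sum_mem fun _ _ => sum_mem fun _ _ => Subalgebra.smul_mem _
      (evE_mem_xFree (mul_mem (evar_W_mem_xFreeFun _ _) (evar_W_mem_xFreeFun _ _))) _)
    (Subalgebra.smul_mem _ (sum_mem fun _ _ => oddProdE_W_mem_xFree _ _ _ _) _)

theorem hodgesOffE_mem_xFree (s : ℂ) (i j : Particle m) : hodgesOffE s i j ∈ xFree m τ ξ :=
  neg_mem (mul_mem (wbrE_mem_xFree s i j)
    (evE_mem_xFree (ringInverse_mem_xFreeFun (sbr_mem_xFreeFun i j))))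

theorem hodgesE_mem_xFree (s : ℂ) (ζ : Fin 2 → ℂ) (i j : Particle m) :
    hodgesE s ζ i j ∈ xFree m τ ξ := by
  rw [hodgesE_apply]
  split_ifs
  · exact neg_mem (sum_mem fun k _ => mul_mem (hodgesOffE_mem_xFree s i k)
      (evE_mem_xFree (mul_mem (pow_mem (rbr_mem_xFreeFun ζ k) 2)
        (pow_mem (ringInverse_mem_xFreeFun (rbr_mem_xFreeFun ζ i)) 2))))
  · exact hodgesOffE_mem_xFree s i j

theorem xsqE_mem_leibniz (s : ℂ) : xsqE s ∈ leibnizSubalgebra m τ ξ := by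
  rw [xsqE_eq]
  exact add_mem
    (sum_mem fun _ _ => sum_mem fun _ _ => Subalgebra.smul_mem _ (evE_mem_leibniz _) _)
    (Subalgebra.smul_mem _ (sum_mem fun _ _ => oddProdE_mem_leibniz _ _) _)

/-- `Wᵢ · X_A`. -/
def wDotX (i : Particle m) (A : Fin 2) : EvenRing m τ ξ :=
  (∑ α : Fin 4, evE (evar (EvenVar.W i α) * evar (EvenVar.X α A))) +
    ∑ a : Fin 4, oddProdE (OddVar.W i a) (OddVar.X a A)

/-- `expo` with values in `EvenRing`. -/
def expoE (m : ℕ) (τ : Fin 2 → Fin 2 → ℂ) (ξ : Fin 2 → ℂ) : EvenRing m τ ξ := expo m τ ξ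

theorem expoE_eq : expoE m τ ξ =
    Complex.I • ∑ i : Particle m, ∑ A : Fin 2, evE (sig i A) * wDotX i A := by rfl

theorem evenDer_evar_mul_evar (α β : Fin 4) (A B : Fin 2) (i : Particle m) :
    evenDer m τ ξ (EvenVar.X β B) (evar (EvenVar.W i α) * evar (EvenVar.X α A)) =
      if α = β ∧ A = B then evar (EvenVar.W i β) else 0 := by
  rw [Derivation.leibniz, evenDer_evar, evenDer_evar, if_neg (by simp : ¬ EvenVar.W i α = _)]
  by_cases h : α = β ∧ A = B
  · obtain ⟨rfl, rfl⟩ := h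
    simp
  · simp [h]

theorem partialDer_even_wDotX (β : Fin 4) (B : Fin 2) (i : Particle m) (A : Fin 2) :
    partialDer m τ ξ (IntVar.even β B) (incl (wDotX i A)) =
      if A = B then incl (evE (evar (EvenVar.W i β))) else 0 := by
  simp only [wDotX, map_add, map_sum, partialDer_even_evE, partialDer_even_oddProdE,
    Finset.sum_const_zero, add_zero, evenDer_evar_mul_evar]
  by_cases h : A = B
  · subst h
    rw [Finset.sum_eq_single β]
    · simp
    · intro α _ hα; simp [hα]
    · simp
  · simp [h]

theorem partialDer_odd_wDotX (b : Fin 4) (B : Fin 2) (i : Particle m) (A : Fin 2) :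
    partialDer m τ ξ (IntVar.odd b B) (incl (wDotX i A)) =
      if A = B then (-1 : ℂ) • oddElt (OddVar.W i b) else 0 := by
  classical
  simp only [wDotX, map_add, map_sum, partialDer_odd_evE, partialDer_odd_oddProdE,
    Finset.sum_const_zero, zero_add, Finsupp.single_apply]
  by_cases h : A = B
  · subst h
    rw [Finset.sum_eq_single b]
    · simp only [reduceCtorEq, if_false, zero_smul, if_true, one_smul, zero_sub]
      exact (neg_one_smul ℂ _).symm
    · intro α _ hα; simp [hα]
    · simp
  · simp [h]

theorem partialDer_sig_wDotX (j : Fin m) (B : Fin 2) (i : Particle m) (A : Fin 2) :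
    partialDer m τ ξ (IntVar.sig j B) (incl (wDotX i A)) = 0 := by
  simp only [wDotX, map_add, map_sum, partialDer_sig_evE, partialDer_sig_oddProdE,
    Derivation.leibniz, smul_eq_mul]
  simp [evenDer_evar_of_ne]

theorem partialDer_even_expoE (β : Fin 4) (B : Fin 2) :
    partialDer m τ ξ (IntVar.even β B) (incl (expoE m τ ξ)) =
      Complex.I • ∑ i : Particle m, incl (evE (sig i B)) * incl (evE (evar (EvenVar.W i β))) := by
  simp only [expoE_eq, map_smul, map_sum, map_mul incl, leibniz_of_mem (evE_mem_leibniz _),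
    partialDer_even_evE, evenDer_X_sig, partialDer_even_wDotX, map_zero, zero_mul, zero_add]
  simp

theorem partialDer_odd_expoE (b : Fin 4) (B : Fin 2) :
    partialDer m τ ξ (IntVar.odd b B) (incl (expoE m τ ξ)) =
      (-Complex.I) • ∑ i : Particle m, incl (evE (sig i B)) * oddElt (OddVar.W i b) := by
  simp only [expoE_eq, map_smul, map_sum, map_mul incl, leibniz_of_mem (evE_mem_leibniz _),
    partialDer_odd_evE, partialDer_odd_wDotX, zero_mul, zero_add, mul_ite, mul_zero,
    Finset.sum_ite_eq', Finset.mem_univ, if_true, mul_smul_comm]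
  rw [← Finset.smul_sum, smul_smul, mul_neg_one]

theorem evenDer_sig_sig (i j : Fin m) (A B : Fin 2) :
    evenDer m τ ξ (EvenVar.sig i A) (sig (Sum.inr j) B) = if j = i ∧ B = A then 1 else 0 := by
  rw [sig_inr, evenDer_evar]
  simp

theorem evenDer_sig_inl (i : Fin m) (A B : Fin 2) (a : Fin 2) :
    evenDer m τ ξ (EvenVar.sig i A) (sig (Sum.inl a) B) = 0 := by
  rw [sig_inl, evenDer_cst]

theorem partialDer_sig_expoE (i : Fin m) (A : Fin 2) :
    partialDer m τ ξ (IntVar.sig i A) (incl (expoE m τ ξ)) =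
      incl (Complex.I • wDotX (Sum.inr i) A) := by
  simp only [expoE_eq, map_smul, map_sum, map_mul incl, leibniz_of_mem (evE_mem_leibniz _),
    partialDer_sig_evE, mul_zero, add_zero, partialDer_sig_wDotX]
  simp only [Fintype.sum_sum_type, evenDer_sig_inl, evenDer_sig_sig, map_zero, zero_mul,
    Finset.sum_const_zero, zero_add]
  rw [Finset.sum_eq_single i, Finset.sum_eq_single A]
  · simp
  · intro B _ hB; simp [hB]
  · simp
  · intro j _ hj; simp [hj]
  · simp

theorem sigDer_xsqE (i : Fin m) (A : Fin 2) (s : ℂ) :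
    sigDer i A (xsqE s : EvenRing m τ ξ) = 0 := by
  simp only [xsqE_eq, map_add, map_sum, Derivation.map_smul, sigDer_evE, sigDer_oddProdE,
    Derivation.leibniz, smul_eq_mul]
  simp [evenDer_evar_of_ne]

theorem sigDer_wbrE (i : Fin m) (A : Fin 2) (s : ℂ) (j k : Particle m) :
    sigDer i A (wbrE s j k : EvenRing m τ ξ) = 0 := by
  simp only [wbrE_eq, map_sub, map_sum, Derivation.map_smul, sigDer_evE, sigDer_oddProdE,
    Derivation.leibniz, smul_eq_mul]
  simp [evenDer_evar_of_ne]

/-! ### Integration by parts -/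

theorem totalDer_apply (v : IntVar m) (F : Integrand m τ ξ) :
    totalDer m τ ξ v F =
      partialDer m τ ξ v F + partialDer m τ ξ v (incl (expoE m τ ξ)) * F := by rfl

theorem totalDer_mem (v : IntVar m) (F : Integrand m τ ξ) :
    totalDer m τ ξ v F ∈ totalDerivatives m τ ξ :=
  Submodule.mem_iSup_of_mem v ⟨F, rfl⟩

/-- The derivative `[Wᵢ, ∂/∂X_A]`. -/
def twistDer (s : ℂ) (i : Particle m) (A : Fin 2) : Integrand m τ ξ →ₗ[ℂ] Integrand m τ ξ :=
  (∑ α : Fin 4, ∑ β : Fin 4, infUpper (s ^ 2) α β •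
    (LinearMap.mulLeft ℂ (incl (evE (evar (EvenVar.W i α))))).comp
      (partialDer m τ ξ (IntVar.even β A))) +
  s • ∑ a : Fin 4, (LinearMap.mulLeft ℂ (oddElt (OddVar.W i a))).comp
    (partialDer m τ ξ (IntVar.odd a A))

theorem twistDer_apply (s : ℂ) (i : Particle m) (A : Fin 2) (F : Integrand m τ ξ) :
    twistDer s i A F =
      (∑ α : Fin 4, ∑ β : Fin 4, infUpper (s ^ 2) α β •
        (incl (evE (evar (EvenVar.W i α))) * partialDer m τ ξ (IntVar.even β A) F)) +
      s • ∑ a : Fin 4, oddElt (OddVar.W i a) * partialDer m τ ξ (IntVar.odd a A) F := by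
  simp only [twistDer, LinearMap.add_apply, LinearMap.sum_apply, LinearMap.smul_apply,
    LinearMap.comp_apply, LinearMap.mulLeft_apply]

theorem twistDer_mul {z : EvenRing m τ ξ} (hz : z ∈ leibnizSubalgebra m τ ξ) (s : ℂ)
    (i : Particle m) (A : Fin 2) (F : Integrand m τ ξ) :
    twistDer s i A (incl z * F) = twistDer s i A (incl z) * F + incl z * twistDer s i A F := by
  have h : ∀ w G : Integrand m τ ξ, w * (incl z * G) = incl z * (w * G) := fun w G => by
    rw [← mul_assoc, incl_comm, mul_assoc]
  simp only [twistDer_apply, leibniz_of_mem hz, mul_add, add_mul, Finset.sum_add_distrib,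
    smul_add, Finset.sum_mul, Finset.mul_sum, smul_mul_assoc, mul_smul_comm, h, mul_assoc]
  abel

theorem twistDer_eq_zero {z : EvenRing m τ ξ} (hz : z ∈ xFree m τ ξ) (s : ℂ)
    (i : Particle m) (A : Fin 2) : twistDer s i A (incl z) = 0 := by
  simp only [twistDer_apply, hz.2.1, hz.2.2, mul_zero, smul_zero, Finset.sum_const_zero, add_zero]

theorem mul_totalDer_even_mem {z : EvenRing m τ ξ} (hz : z ∈ xFree m τ ξ) (α : Fin 4) (A : Fin 2)
    (F : Integrand m τ ξ) :
    incl z * totalDer m τ ξ (IntVar.even α A) F ∈ totalDerivatives m τ ξ := by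
  have h : incl z * totalDer m τ ξ (IntVar.even α A) F =
      totalDer m τ ξ (IntVar.even α A) (incl z * F) := by
    rw [totalDer_apply, totalDer_apply, leibniz_of_mem hz.1, hz.2.1, zero_mul, zero_add, mul_add,
      ← mul_assoc, ← incl_comm z (partialDer m τ ξ _ (incl (expoE m τ ξ))), mul_assoc]
  rw [h]
  exact totalDer_mem _ _

/-- An odd component of `W_i` anticommutes with the odd derivative, as it does not involve `X`, and
with the odd derivative of the exponent. It can thus be pulled inside the total derivative at the
cost of one overall sign. -/
theorem oddElt_mul_totalDer_mem (i : Particle m) (a b : Fin 4) (A : Fin 2)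
    (F : Integrand m τ ξ) :
    oddElt (OddVar.W i a) * totalDer m τ ξ (IntVar.odd b A) F ∈ totalDerivatives m τ ξ := by
  have h1 : ∀ j : Particle m, (oddElt (OddVar.W i a) * (incl (evE (sig j A)) *
      oddElt (OddVar.W j b)) : Integrand m τ ξ) =
      (-1 : ℂ) • (incl (evE (sig j A)) * oddElt (OddVar.W j b) * oddElt (OddVar.W i a)) := by
    intro j
    rw [← mul_assoc, incl_comm, mul_assoc, oddElt_anticomm, mul_assoc, ← mul_smul_comm]
    exact congrArg _ (neg_one_smul ℂ _).symm
  have h2 : oddElt (OddVar.W i a) * partialDer m τ ξ (IntVar.odd b A) (incl (expoE m τ ξ)) =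
      (-1 : ℂ) • (partialDer m τ ξ (IntVar.odd b A) (incl (expoE m τ ξ)) *
        oddElt (OddVar.W i a)) := by
    rw [partialDer_odd_expoE, mul_smul_comm, smul_mul_assoc, Finset.mul_sum, Finset.sum_mul,
      Finset.sum_congr rfl fun j _ => h1 j, ← Finset.smul_sum, smul_comm]
  have h3 : partialDer m τ ξ (IntVar.odd b A) (oddElt (OddVar.W i a) * F) =
      (-1 : ℂ) • (oddElt (OddVar.W i a) * partialDer m τ ξ (IntVar.odd b A) F) := by
    classical
    rw [partialDer_odd_oddElt_mul, Finsupp.single_apply, if_neg (by simp), zero_smul, zero_sub]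
    exact (neg_one_smul ℂ _).symm
  have h : oddElt (OddVar.W i a) * totalDer m τ ξ (IntVar.odd b A) F =
      (-1 : ℂ) • totalDer m τ ξ (IntVar.odd b A) (oddElt (OddVar.W i a) * F) := by
    rw [totalDer_apply, totalDer_apply, h3, smul_add, smul_smul, mul_add, ← mul_assoc, h2,
      smul_mul_assoc, mul_assoc, show (-1 : ℂ) * -1 = 1 by norm_num, one_smul]
  rw [h]
  exact Submodule.smul_mem _ _ (totalDer_mem _ _)

theorem twistDer_add_mem (s : ℂ) (i : Particle m) (A : Fin 2) (F : Integrand m τ ξ) :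
    twistDer s i A F + twistDer s i A (incl (expoE m τ ξ)) * F ∈ totalDerivatives m τ ξ := by
  have h : twistDer s i A F + twistDer s i A (incl (expoE m τ ξ)) * F =
      (∑ α : Fin 4, ∑ β : Fin 4, infUpper (s ^ 2) α β •
        (incl (evE (evar (EvenVar.W i α))) * totalDer m τ ξ (IntVar.even β A) F)) +
      s • ∑ a : Fin 4, oddElt (OddVar.W i a) * totalDer m τ ξ (IntVar.odd a A) F := by
    simp only [twistDer_apply, totalDer_apply, mul_add, add_mul, Finset.sum_add_distrib,
      smul_add, Finset.sum_mul, smul_mul_assoc, mul_assoc]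
    abel
  rw [h]
  exact add_mem (sum_mem fun α _ => sum_mem fun β _ => Submodule.smul_mem _ _
      (mul_totalDer_even_mem (evE_mem_xFree (evar_W_mem_xFreeFun i α)) β A F))
    (Submodule.smul_mem _ _ (sum_mem fun a _ => oddElt_mul_totalDer_mem i a a A F))

/-- The component `[Wᵢ, P^A]` of the momentum. -/
def momentum (s : ℂ) (i : Particle m) (A : Fin 2) : EvenRing m τ ξ :=
  ∑ j : Particle m, wbrE s i j * evE (sig j A)

/-- The exponent is linear in `X` with coefficients `W_j σ_j^A`, so contracting its gradient with
`W_i` produces `[W_i, W_j] σ_j^A`. The minus sign of the fermionic part of `wbr` is the one from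
moving the odd derivative past `W_j`. -/
theorem twistDer_expoE (s : ℂ) (i : Particle m) (A : Fin 2) :
    twistDer s i A (incl (expoE m τ ξ)) = incl (Complex.I • momentum s i A) := by
  have h1 : ∀ (α β : Fin 4), incl (evE (evar (EvenVar.W i α))) *
      partialDer m τ ξ (IntVar.even β A) (incl (expoE m τ ξ)) = incl (Complex.I •
        ∑ j : Particle m, evE (evar (EvenVar.W i α) * evar (EvenVar.W j β)) * evE (sig j A)) := by
    intro α β
    rw [partialDer_even_expoE, mul_smul_comm, map_smul, map_sum, Finset.mul_sum]
    refine congrArg _ (Finset.sum_congr rfl fun j _ => ?_)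
    rw [map_mul incl, map_mul evE, map_mul incl, incl_comm, mul_assoc, incl_comm]
  have h2 : ∀ a : Fin 4, oddElt (OddVar.W i a) *
      partialDer m τ ξ (IntVar.odd a A) (incl (expoE m τ ξ)) = incl ((-Complex.I) •
        ∑ j : Particle m, oddProdE (OddVar.W i a) (OddVar.W j a) * evE (sig j A)) := by
    intro a
    rw [partialDer_odd_expoE, mul_smul_comm, map_smul, map_sum, Finset.mul_sum]
    refine congrArg _ (Finset.sum_congr rfl fun j _ => ?_)
    rw [map_mul incl, incl_oddProdE, incl_comm, ← mul_assoc, incl_comm, mul_assoc]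
  have h3 : momentum s i A = (∑ α : Fin 4, ∑ β : Fin 4, infUpper (s ^ 2) α β •
        ∑ j : Particle m, evE (evar (EvenVar.W i α) * evar (EvenVar.W j β)) * evE (sig j A)) -
      s • ∑ a : Fin 4, ∑ j : Particle m,
        (oddProdE (OddVar.W i a) (OddVar.W j a) * evE (sig j A) : EvenRing m τ ξ) := by
    simp only [momentum, wbrE_eq, sub_mul, Finset.sum_sub_distrib, Finset.sum_mul,
      smul_mul_assoc]
    congr 1
    · rw [Finset.sum_comm]
      refine Finset.sum_congr rfl fun α _ => ?_
      rw [Finset.sum_comm]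
      exact Finset.sum_congr rfl fun β _ => (Finset.smul_sum ..).symm
    · rw [← Finset.smul_sum, Finset.sum_comm]
  rw [twistDer_apply, h3]
  simp only [h1, h2]
  simp only [← map_smul, ← map_sum, ← map_add]
  congr 1
  simp only [smul_add, Finset.smul_sum, smul_comm _ Complex.I, neg_smul, smul_neg,
    Finset.sum_neg_distrib, sub_eq_add_neg]

theorem partialDer_even_zero_xsqE (s : ℂ) (β : Fin 4) :
    partialDer m τ ξ (IntVar.even β 0) (incl (xsqE s)) =
      incl (∑ α, infLower (s ^ 2) β α • evE (evar (EvenVar.X α 1))) := by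
  simp only [xsqE_eq, map_add, map_sum, map_smul, partialDer_even_evE, partialDer_even_oddProdE,
    Derivation.leibniz, evenDer_evar, smul_zero, Finset.sum_const_zero, add_zero]
  rw [Finset.sum_eq_single β]
  · simp
  · intro α _ hα; simp [hα]
  · simp

theorem partialDer_even_one_xsqE (s : ℂ) (β : Fin 4) :
    partialDer m τ ξ (IntVar.even β 1) (incl (xsqE s)) =
      incl (∑ α, infLower (s ^ 2) α β • evE (evar (EvenVar.X α 0))) := by
  simp only [xsqE_eq, map_add, map_sum, map_smul, partialDer_even_evE, partialDer_even_oddProdE,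
    Derivation.leibniz, evenDer_evar, smul_zero, Finset.sum_const_zero, add_zero]
  refine Finset.sum_congr rfl fun α _ => ?_
  rw [Finset.sum_eq_single β]
  · simp
  · intro α _ hα; simp [hα]
  · simp

theorem partialDer_odd_zero_xsqE (s : ℂ) (b : Fin 4) :
    partialDer m τ ξ (IntVar.odd b 0) (incl (xsqE s)) = s • oddElt (OddVar.X b 1) := by
  classical
  simp only [xsqE_eq, map_add, map_sum, map_smul, partialDer_odd_evE, partialDer_odd_oddProdE,
    smul_zero, Finset.sum_const_zero, zero_add, Finsupp.single_apply]
  rw [Finset.sum_eq_single b]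
  · simp
  · intro α _ hα; simp [hα]
  · simp

theorem partialDer_odd_one_xsqE (s : ℂ) (b : Fin 4) :
    partialDer m τ ξ (IntVar.odd b 1) (incl (xsqE s)) = (-s) • oddElt (OddVar.X b 0) := by
  classical
  simp only [xsqE_eq, map_add, map_sum, map_smul, partialDer_odd_evE, partialDer_odd_oddProdE,
    smul_zero, Finset.sum_const_zero, zero_add, Finsupp.single_apply]
  rw [Finset.sum_eq_single b]
  · have h : (-s) • (oddElt (OddVar.X b 0) : Integrand m τ ξ) =
        s • (0 - oddElt (OddVar.X b 0)) := by
      rw [zero_sub, smul_neg]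
      exact neg_smul s (oddElt (OddVar.X b 0) : Integrand m τ ξ)
    rw [h]
    simp
  · intro α _ hα; simp [hα]
  · simp

/-- `X²` is bilinear with matrix `I_{IJ}`; contracting its gradient with `I^{IJ}` leaves `Λ` times
the identity. The result is the factor which `∂/∂σ_i` brings down from the exponential, and this
match links the two integrations by parts. -/
theorem twistDer_zero_xsqE (s : ℂ) (i : Particle m) :
    twistDer s i 0 (incl (xsqE s : EvenRing m τ ξ)) = incl (s ^ 2 • wDotX i 1) := by
  have h1 : ∀ α β : Fin 4, (incl (evE (evar (EvenVar.W i α))) *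
      incl (evE (evar (EvenVar.X β 1))) : Integrand m τ ξ) =
        incl (evE (evar (EvenVar.W i α) * evar (EvenVar.X β 1))) := fun α β => by
    rw [map_mul evE, map_mul incl]
  simp only [twistDer_apply, partialDer_even_zero_xsqE, partialDer_odd_zero_xsqE, map_sum,
    map_smul, Finset.mul_sum, mul_smul_comm, h1, ← incl_oddProdE]
  simp only [← map_smul, ← map_sum, ← map_add]
  congr 1
  simp [Fin.sum_univ_four, infUpper, infLower, wDotX]
  module

theorem twistDer_one_xsqE (s : ℂ) (i : Particle m) :
    twistDer s i 1 (incl (xsqE s : EvenRing m τ ξ)) = incl ((-s ^ 2) • wDotX i 0) := by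
  have h1 : ∀ α β : Fin 4, (incl (evE (evar (EvenVar.W i α))) *
      incl (evE (evar (EvenVar.X β 0))) : Integrand m τ ξ) =
        incl (evE (evar (EvenVar.W i α) * evar (EvenVar.X β 0))) := fun α β => by
    rw [map_mul evE, map_mul incl]
  simp only [twistDer_apply, partialDer_even_one_xsqE, partialDer_odd_one_xsqE, map_sum,
    map_smul, Finset.mul_sum, mul_smul_comm, h1, ← incl_oddProdE]
  simp only [← map_smul, ← map_sum, ← map_add]
  congr 1
  simp [Fin.sum_univ_four, infUpper, infLower, wDotX]
  module

/-- Integration by parts in `X`. -/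
theorem twist_mem {z f y : EvenRing m τ ξ} (hz : z ∈ leibnizSubalgebra m τ ξ)
    (hf : f ∈ xFree m τ ξ) (s : ℂ) (i : Particle m) (A : Fin 2)
    (hy : twistDer s i A (incl z) = incl y) :
    incl (y * f + Complex.I • (momentum s i A * (z * f))) ∈ totalDerivatives m τ ξ := by
  have h := twistDer_add_mem s i A (incl (z * f) : Integrand m τ ξ)
  rwa [twistDer_expoE, map_mul incl z, twistDer_mul hz, twistDer_eq_zero hf, mul_zero, add_zero,
    hy, ← map_mul, ← map_mul, ← map_mul, ← map_add, smul_mul_assoc] at h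

/-- Integration by parts in `σᵢ`. -/
theorem sigDer_mem (i : Fin m) (A : Fin 2) (z : EvenRing m τ ξ) :
    incl (sigDer i A z + Complex.I • (wDotX (Sum.inr i) A * z)) ∈ totalDerivatives m τ ξ := by
  have h := totalDer_mem (IntVar.sig i A) (incl z)
  rwa [totalDer_apply, partialDer_sig_expoE, ← incl_sigDer, ← map_mul, ← map_add,
    smul_mul_assoc] at h

/-- `[Wᵢ, P(η)]`. -/
def momentumAt (s : ℂ) (i : Particle m) (η : Fin 2 → EvenFun m τ ξ) : EvenRing m τ ξ :=
  ∑ j : Particle m, wbrE s i j * evE (br η (sig j))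

theorem momentumAt_eq (s : ℂ) (i : Particle m) (η : Fin 2 → EvenFun m τ ξ) :
    momentumAt s i η = evE (η 0) * momentum s i 1 - evE (η 1) * momentum s i 0 := by
  simp only [momentumAt, momentum, br, map_sub, map_mul, Finset.mul_sum, mul_sub,
    Finset.sum_sub_distrib]
  congr 1 <;> exact Finset.sum_congr rfl fun j _ => by ring

/-- The mechanism that produces a factor `Λ`. Integration by parts in `X` trades the momentum for `2
Λ X² ∑_A (W_i · X_A) η^A`, up to a power of the imaginary unit; integration by parts in `σ_i` then
trades `W_i · X_A` for a derivative of `η^A f`, because `X²` is independent of `σ_i`. -/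
theorem xsqE_sq_mul_momentumAt_mem (s : ℂ) (i : Fin m) {η : Fin 2 → EvenFun m τ ξ}
    (hη : ∀ A, η A ∈ xFreeFun m τ ξ) {f : EvenRing m τ ξ} (hf : f ∈ xFree m τ ξ) :
    incl (xsqE s ^ 2 * (momentumAt s (Sum.inr i) η * f) -
      (2 * s ^ 2) • (xsqE s * ∑ A, sigDer i A (evE (η A) * f))) ∈ totalDerivatives m τ ξ := by
  have hx := xsqE_mem_leibniz (m := m) (τ := τ) (ξ := ξ) s
  have hsq : ∀ A (y : EvenRing m τ ξ), twistDer s (Sum.inr i) A (incl (xsqE s)) = incl y →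
      twistDer s (Sum.inr i) A (incl (xsqE s ^ 2)) = incl ((2 : ℂ) • (xsqE s * y)) := by
    intro A y hy
    rw [pow_two, map_mul, twistDer_mul hx, hy, incl_comm, ← map_mul, ← map_add, two_smul]
  -- The spinor index is crossed: `η 0` goes with the component 1 of the momentum and `η 1` with the
  -- component 0, as in the product `(η σ)`.
  have h1 := twist_mem (pow_mem hx 2) (mul_mem (evE_mem_xFree (hη 0)) hf) s (Sum.inr i) 1
    (hsq 1 _ (twistDer_one_xsqE s _))
  have h0 := twist_mem (pow_mem hx 2) (mul_mem (evE_mem_xFree (hη 1)) hf) s (Sum.inr i) 0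
    (hsq 0 _ (twistDer_zero_xsqE s _))
  have h2 := sigDer_mem i 0 (xsqE s * (evE (η 0) * f))
  have h3 := sigDer_mem i 1 (xsqE s * (evE (η 1) * f))
  have h4 := sub_mem (sub_mem (Submodule.smul_mem _ (-Complex.I) (sub_mem h1 h0))
    (Submodule.smul_mem _ (2 * s ^ 2) h2)) (Submodule.smul_mem _ (2 * s ^ 2) h3)
  simp only [← map_sub, ← map_smul] at h4
  convert h4 using 2
  rw [momentumAt_eq, Fin.sum_univ_two, Derivation.leibniz (sigDer i 0) (xsqE s),
    Derivation.leibniz (sigDer i 1) (xsqE s), sigDer_xsqE, sigDer_xsqE]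
  have hI : (algebraMap ℂ (EvenRing m τ ξ) Complex.I) ^ 2 = -1 := by
    rw [← map_pow, Complex.I_sq, map_neg, map_one]
  simp only [Algebra.smul_def, map_mul, map_pow, map_neg, map_ofNat]
  linear_combination (xsqE s ^ 2 * f * (evE (η 0) * momentum s (Sum.inr i) 1 -
    evE (η 1) * momentum s (Sum.inr i) 0)) * hI

/-- The term in which the derivative hits `X²` is proportional to `Λ`, so at `Λ = 0` momentum
conservation holds in the presence of `X²`. -/
theorem xsqE_zero_mul_momentum_mem (i : Particle m) (A : Fin 2) {f : EvenRing m τ ξ}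
    (hf : f ∈ xFree m τ ξ) :
    incl (xsqE 0 * (momentum 0 i A * f)) ∈ totalDerivatives m τ ξ := by
  have hx := xsqE_mem_leibniz (m := m) (τ := τ) (ξ := ξ) 0
  have hy : twistDer 0 i A (incl (xsqE 0 : EvenRing m τ ξ)) = incl 0 := by
    fin_cases A
    · exact (twistDer_zero_xsqE 0 i).trans (by simp)
    · exact (twistDer_one_xsqE 0 i).trans (by simp)
  have h := Submodule.smul_mem _ (-Complex.I) (twist_mem hx hf 0 i A hy)
  rw [← map_smul, zero_mul, zero_add, smul_smul, neg_mul, Complex.I_mul_I, neg_neg, one_smul] at h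
  convert h using 2
  ring

/-! ### Invertible spinor products -/

theorem isUnit_of_dvd_denom {p : MvPolynomial (EvenVar m) ℂ} (h : p ∣ denom m τ ξ) :
    IsUnit (algebraMap _ (EvenFun m τ ξ) p) :=
  isUnit_of_dvd_unit (map_dvd _ h)
    (IsLocalization.map_units (EvenFun m τ ξ)
      (⟨denom m τ ξ, Submonoid.mem_powers _⟩ : Submonoid.powers (denom m τ ξ)))

theorem algebraMap_br (u v : Fin 2 → MvPolynomial (EvenVar m) ℂ) :
    algebraMap _ (EvenFun m τ ξ) (br u v) =
      br (fun A => algebraMap _ (EvenFun m τ ξ) (u A)) fun A => algebraMap _ _ (v A) := by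
  simp only [br, map_sub, map_mul]

theorem br_swap {R : Type*} [CommRing R] (u v : Fin 2 → R) : br u v = -br v u := by
  simp only [br]; ring

theorem sbr_swap (i j : Particle m) : (sbr i j : EvenFun m τ ξ) = -sbr j i := br_swap _ _

theorem factor_dvd_denom (i : Fin m) :
    br (sigPoly m τ (Sum.inl 0)) (sigPoly m τ (Sum.inr i)) *
      br (sigPoly m τ (Sum.inl 1)) (sigPoly m τ (Sum.inr i)) *
      br (fun A => MvPolynomial.C (ξ A)) (sigPoly m τ (Sum.inr i)) ∣ denom m τ ξ :=
  (Finset.dvd_prod_of_mem (fun i : Fin m =>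
    br (sigPoly m τ (Sum.inl 0)) (sigPoly m τ (Sum.inr i)) *
      br (sigPoly m τ (Sum.inl 1)) (sigPoly m τ (Sum.inr i)) *
      br (fun A => MvPolynomial.C (ξ A)) (sigPoly m τ (Sum.inr i))) (Finset.mem_univ i)).trans
    (Dvd.intro _ rfl)

theorem isUnit_sbr_inl (p : Fin 2) (i : Fin m) :
    IsUnit (sbr (Sum.inl p) (Sum.inr i) : EvenFun m τ ξ) := by
  have h : br (sigPoly m τ (Sum.inl p)) (sigPoly m τ (Sum.inr i)) ∣ denom m τ ξ := by
    refine Dvd.dvd.trans ?_ (factor_dvd_denom i)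
    fin_cases p
    · exact (Dvd.intro _ rfl).trans (Dvd.intro _ rfl)
    · exact (Dvd.intro_left _ rfl).trans (Dvd.intro _ rfl)
  have := isUnit_of_dvd_denom h
  rwa [algebraMap_br] at this

theorem isUnit_rbr (i : Fin m) : IsUnit (rbr ξ (Sum.inr i) : EvenFun m τ ξ) := by
  have := isUnit_of_dvd_denom ((Dvd.intro_left _ rfl).trans (factor_dvd_denom (τ := τ) (ξ := ξ) i))
  rwa [algebraMap_br] at this

theorem isUnit_sbr_inr {i j : Fin m} (h : i ≠ j) :
    IsUnit (sbr (Sum.inr i) (Sum.inr j) : EvenFun m τ ξ) := by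
  wlog hij : i < j generalizing i j
  · rw [sbr_swap]
    exact (this h.symm (lt_of_le_of_ne (not_lt.1 hij) h.symm)).neg
  have hd : br (sigPoly m τ (Sum.inr i)) (sigPoly m τ (Sum.inr j)) ∣ denom m τ ξ :=
    (Finset.dvd_prod_of_mem (fun p : Fin m × Fin m =>
      br (sigPoly m τ (Sum.inr p.1)) (sigPoly m τ (Sum.inr p.2)))
      (Finset.mem_filter.2 ⟨Finset.mem_univ (i, j), hij⟩)).trans (Dvd.intro_left _ rfl)
  have := isUnit_of_dvd_denom hd
  rwa [algebraMap_br] at this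

theorem isUnit_sbr {i : Fin m} {k : Particle m} (h : k ≠ Sum.inr i) :
    IsUnit (sbr (Sum.inr i) k : EvenFun m τ ξ) := by
  rcases k with p | j
  · rw [sbr_swap]
    exact (isUnit_sbr_inl p i).neg
  · exact isUnit_sbr_inr fun hij => h (by rw [hij])

theorem ringInverse_neg {R : Type*} [CommRing R] (x : R) :
    Ring.inverse (-x) = -Ring.inverse x := by
  by_cases h : IsUnit x
  · exact h.neg.mul_left_cancel (by
      rw [Ring.mul_inverse_cancel _ h.neg, neg_mul_neg, Ring.mul_inverse_cancel _ h])
  · rw [Ring.inverse_non_unit _ h, Ring.inverse_non_unit _ (by rwa [IsUnit.neg_iff]), neg_zero]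

/-! ### Symmetry of the Hodges matrix -/

theorem infUpper_swap (Λ : ℂ) (α β : Fin 4) : infUpper Λ β α = -infUpper Λ α β := by
  fin_cases α <;> fin_cases β <;> simp [infUpper]

theorem wbrE_swap (s : ℂ) (i j : Particle m) : (wbrE s j i : EvenRing m τ ξ) = -wbrE s i j := by
  have h1 : ∑ a : Fin 4, (oddProdE (OddVar.W j a) (OddVar.W i a) : EvenRing m τ ξ) =
      -∑ a : Fin 4, oddProdE (OddVar.W i a) (OddVar.W j a) := by
    rw [← Finset.sum_neg_distrib]
    exact Finset.sum_congr rfl fun a _ => oddProdE_anticomm _ _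
  have h2 : ∑ α : Fin 4, ∑ β : Fin 4, infUpper (s ^ 2) α β •
      (evE (evar (EvenVar.W j α) * evar (EvenVar.W i β)) : EvenRing m τ ξ) =
      -∑ α : Fin 4, ∑ β : Fin 4, infUpper (s ^ 2) α β •
        evE (evar (EvenVar.W i α) * evar (EvenVar.W j β)) := by
    rw [Finset.sum_comm, ← Finset.sum_neg_distrib]
    refine Finset.sum_congr rfl fun α _ => ?_
    rw [← Finset.sum_neg_distrib]
    exact Finset.sum_congr rfl fun β _ => by
      rw [infUpper_swap _ α β, neg_smul, mul_comm]
  rw [wbrE_eq, wbrE_eq, h1, h2, smul_neg]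
  ring

theorem wbrE_self (s : ℂ) (i : Particle m) : (wbrE s i i : EvenRing m τ ξ) = 0 := by
  have h : (2 : ℂ) • (wbrE s i i : EvenRing m τ ξ) = 0 := by
    rw [two_smul]
    nth_rw 1 [wbrE_swap]
    exact neg_add_cancel _
  rw [← one_smul ℂ (wbrE s i i : EvenRing m τ ξ), ← inv_mul_cancel₀ (two_ne_zero (α := ℂ)),
    mul_smul, h, smul_zero]

theorem hodgesOffE_swap (s : ℂ) (i j : Particle m) :
    (hodgesOffE s j i : EvenRing m τ ξ) = hodgesOffE s i j := by
  rw [hodgesOffE_eq, hodgesOffE_eq, wbrE_swap, sbr_swap, ringInverse_neg, map_neg, neg_mul_neg]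

/-- The Hodges matrix without the rows and columns `1`, `2`. -/
def core (s : ℂ) (ζ : Fin 2 → ℂ) : Matrix (Fin m) (Fin m) (EvenRing m τ ξ) :=
  (hodgesE s ζ).submatrix Sum.inr Sum.inr

theorem core_of_ne (s : ℂ) (ζ : Fin 2 → ℂ) {i j : Fin m} (h : i ≠ j) :
    (core s ζ i j : EvenRing m τ ξ) = hodgesOffE s (Sum.inr i) (Sum.inr j) := by
  change hodgesE s ζ (Sum.inr i) (Sum.inr j) = _
  rw [hodgesE_apply, if_neg (by simpa using h)]

theorem core_self (s : ℂ) (ζ : Fin 2 → ℂ) (i : Fin m) :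
    (core s ζ i i : EvenRing m τ ξ) = -∑ k ∈ Finset.univ.erase (Sum.inr i),
      hodgesOffE s (Sum.inr i) k *
        evE (rbr ζ k ^ 2 * Ring.inverse (rbr ζ (Sum.inr i)) ^ 2) := by
  change hodgesE s ζ (Sum.inr i) (Sum.inr i) = _
  rw [hodgesE_apply, if_pos rfl]

theorem core_isSymm (s : ℂ) (ζ : Fin 2 → ℂ) :
    (core s ζ : Matrix (Fin m) (Fin m) (EvenRing m τ ξ)).IsSymm := by
  ext i j
  rcases eq_or_ne i j with rfl | h
  · rfl
  · rw [Matrix.transpose_apply, core_of_ne s ζ h, core_of_ne s ζ h.symm, hodgesOffE_swap]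

/-! ### The kernel of the Hodges matrix -/

section Spinors

variable {R : Type*} [CommRing R]

/-- The coefficient `(pζ)(qx) + (qζ)(px)`. -/
def etaCoeff (p q z x : Fin 2 → R) : R := br p z * br q x + br q z * br p x

/-- The spinor `((pζ)(qx) + (qζ)(px)) ζ - (pζ)(qζ) x`. -/
def etaSpinor (p q z x : Fin 2 → R) : Fin 2 → R :=
  fun A => etaCoeff p q z x * z A - br p z * br q z * x A

theorem br_etaSpinor_left (p q z x y : Fin 2 → R) :
    br (etaSpinor p q z x) y = etaCoeff p q z x * br z y - br p z * br q z * br x y := by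
  simp only [br, etaSpinor]; ring

theorem br_etaSpinor_right (p q z x y : Fin 2 → R) :
    br y (etaSpinor p q z x) = etaCoeff p q z x * br y z - br p z * br q z * br y x := by
  simp only [br, etaSpinor]; ring

theorem kernel_identity (p q z x y : Fin 2 → R) :
    br p y * br q y * br z x ^ 2 - br p x * br q x * br z y ^ 2 =
      -(br x y * br (etaSpinor p q z x) y) := by
  simp only [br, etaSpinor, etaCoeff]; ring

theorem etaCoeff_antisymm (p q z x y : Fin 2 → R) :
    etaCoeff p q z x * br z y - etaCoeff p q z y * br z x = 2 * (br p z * br q z) * br x y := by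
  simp only [br, etaCoeff]; ring

/-- With `a = (pz)(qx)` and `b = (qz)(px)` this is `(a + b)² - 4ab = (a - b)²`, and `a - b` is
`(pq)(zx)` up to sign by the Schouten identity. -/
theorem etaCoeff_sq (p q z x : Fin 2 → R) :
    etaCoeff p q z x ^ 2 - 4 * (br p z * br q z) * (br p x * br q x) =
      br p q ^ 2 * br z x ^ 2 := by
  simp only [br, etaCoeff]; ring

end Spinors

/-- The spinor along which `σᵢ` is varied. -/
def eta (ζ : Fin 2 → ℂ) (i : Fin m) : Fin 2 → EvenFun m τ ξ :=
  etaSpinor (sig (Sum.inl 0)) (sig (Sum.inl 1)) (cst ζ) (sig (Sum.inr i))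

theorem eta_mem_xFreeFun (ζ : Fin 2 → ℂ) (i : Fin m) (A : Fin 2) :
    eta ζ i A ∈ xFreeFun m τ ξ := by
  have h := fun p : Fin 2 => br_mem_xFreeFun (sig_mem_xFreeFun (τ := τ) (ξ := ξ)
    (Sum.inl p : Particle m)) (cst_mem_xFreeFun ζ)
  exact sub_mem (mul_mem (add_mem (mul_mem (h 0) (sbr_mem_xFreeFun _ _))
    (mul_mem (h 1) (sbr_mem_xFreeFun _ _))) (cst_mem_xFreeFun ζ A))
    (mul_mem (mul_mem (h 0) (h 1)) (sig_mem_xFreeFun _ A))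

/-- The null vector `(1k)(2k)` of the Hodges matrix. -/
def nullVec (k : Particle m) : EvenFun m τ ξ := sbr (Sum.inl 0) k * sbr (Sum.inl 1) k

theorem nullVec_inl (p : Fin 2) : (nullVec (Sum.inl p : Particle m) : EvenFun m τ ξ) = 0 := by
  have h : ∀ k : Particle m, (sbr k k : EvenFun m τ ξ) = 0 := fun k => by
    simp only [sbr, br]; ring
  fin_cases p
  · exact mul_eq_zero_of_left (h _) _
  · exact mul_eq_zero_of_right _ (h _)

/-- Since `(1k)(2k)` vanishes for `k = 1, 2`, the sum may run over all particles. The off-diagonal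
entry at `k` and the term `k` of the diagonal entry then combine by `kernel_identity`, whose factor
`(ik)` cancels the denominator of the Hodges matrix. -/
theorem core_mulVec_nullVec (s : ℂ) (ζ : Fin 2 → ℂ) (i : Fin m)
    (hζ : IsUnit (rbr ζ (Sum.inr i) : EvenFun m τ ξ)) :
    ∑ j, core s ζ i j * evE (nullVec (Sum.inr j) : EvenFun m τ ξ) =
      evE (Ring.inverse (rbr ζ (Sum.inr i)) ^ 2) * momentumAt s (Sum.inr i) (eta ζ i) := by
  have h1 : ∑ j, core s ζ i j * evE (nullVec (Sum.inr j) : EvenFun m τ ξ) =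
      ∑ k : Particle m, hodgesE s ζ (Sum.inr i) k * evE (nullVec k : EvenFun m τ ξ) := by
    rw [Fintype.sum_sum_type]
    simp only [nullVec_inl, map_zero, mul_zero, Finset.sum_const_zero, zero_add]
    rfl
  rw [h1, momentumAt, ← Finset.add_sum_erase _ _ (Finset.mem_univ (Sum.inr i : Particle m)),
    ← Finset.add_sum_erase Finset.univ (fun j => wbrE s (Sum.inr i) j * _)
      (Finset.mem_univ (Sum.inr i : Particle m)), wbrE_self, zero_mul, zero_add,
    hodgesE_apply, if_pos rfl, neg_mul, Finset.sum_mul, Finset.mul_sum, ← Finset.sum_neg_distrib,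
    ← Finset.sum_add_distrib]
  refine Finset.sum_congr rfl fun k hk => ?_
  have hk' : k ≠ Sum.inr i := (Finset.mem_erase.1 hk).1
  rw [hodgesE_apply, if_neg hk'.symm, hodgesOffE_eq]
  have hinv := Ring.mul_inverse_cancel _ (isUnit_sbr (τ := τ) (ξ := ξ) hk')
  have hu := Ring.mul_inverse_cancel _ hζ
  have hid : nullVec k * rbr ζ (Sum.inr i) ^ 2 - nullVec (Sum.inr i) * rbr ζ k ^ 2 =
      -(sbr (Sum.inr i) k * br (eta ζ i) (sig k) : EvenFun m τ ξ) := kernel_identity _ _ _ _ _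
  set v := Ring.inverse (sbr (Sum.inr i) k : EvenFun m τ ξ)
  set u := Ring.inverse (rbr ζ (Sum.inr i) : EvenFun m τ ξ)
  have key : -v * (nullVec k - rbr ζ k ^ 2 * u ^ 2 * nullVec (Sum.inr i)) =
      u ^ 2 * br (eta ζ i) (sig k) := by
    linear_combination (-v * u ^ 2) * hid + (u ^ 2 * br (eta ζ i) (sig k)) * hinv
      + v * nullVec k * (rbr ζ (Sum.inr i) * u + 1) * hu
  have key' := congrArg (fun x => wbrE s (Sum.inr i) k * evE x) key
  simp only [map_mul, map_sub, map_neg] at key' ⊢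
  linear_combination key'

/-! ### The divergence of the thrice-reduced determinants -/

/-- The derivative of functions along `eta`. -/
def etaDerFun (i : Fin m) : Derivation ℂ (EvenFun m τ ξ) (EvenFun m τ ξ) :=
  ∑ A, (eta ξ i A : EvenFun m τ ξ) • evenDer m τ ξ (EvenVar.sig i A)

/-- The derivative of even integrands along `eta`. -/
def etaDer (i : Fin m) : Derivation ℂ (EvenRing m τ ξ) (EvenRing m τ ξ) :=
  ∑ A, (evE (eta ξ i A) : EvenRing m τ ξ) • sigDer i A

theorem etaDerFun_apply (i : Fin m) (f : EvenFun m τ ξ) :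
    etaDerFun i f = eta ξ i 0 * evenDer m τ ξ (EvenVar.sig i 0) f +
      eta ξ i 1 * evenDer m τ ξ (EvenVar.sig i 1) f := by
  simp only [etaDerFun, Fin.sum_univ_two, Derivation.add_apply, Derivation.smul_apply,
    smul_eq_mul]

theorem etaDer_apply (i : Fin m) (z : EvenRing m τ ξ) :
    etaDer i z = evE (eta ξ i 0) * sigDer i 0 z + evE (eta ξ i 1) * sigDer i 1 z := by
  simp only [etaDer, Fin.sum_univ_two, Derivation.add_apply, Derivation.smul_apply, smul_eq_mul]

theorem etaDer_evE (i : Fin m) (f : EvenFun m τ ξ) : etaDer i (evE f) = evE (etaDerFun i f) := by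
  rw [etaDer_apply, etaDerFun_apply, sigDer_evE, sigDer_evE, map_add, map_mul, map_mul]

theorem etaDer_wbrE (i : Fin m) (s : ℂ) (j k : Particle m) :
    etaDer i (wbrE s j k : EvenRing m τ ξ) = 0 := by
  rw [etaDer_apply, sigDer_wbrE, sigDer_wbrE, mul_zero, mul_zero, add_zero]

theorem etaDerFun_cst (i : Fin m) (ζ : Fin 2 → ℂ) (A : Fin 2) :
    etaDerFun i (cst ζ A : EvenFun m τ ξ) = 0 :=
  Derivation.map_algebraMap _ _

theorem etaDerFun_sig_self (i : Fin m) (A : Fin 2) :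
    etaDerFun i (sig (Sum.inr i) A : EvenFun m τ ξ) = eta ξ i A := by
  rw [etaDerFun_apply, evenDer_sig_sig, evenDer_sig_sig]
  fin_cases A <;> simp

theorem etaDerFun_sig_of_ne (i : Fin m) {k : Particle m} (h : k ≠ Sum.inr i) (A : Fin 2) :
    etaDerFun i (sig k A : EvenFun m τ ξ) = 0 := by
  rcases k with p | j
  · rw [sig_inl, etaDerFun_cst]
  · have hj : j ≠ i := fun hj => h (by rw [hj])
    rw [etaDerFun_apply, evenDer_sig_sig, evenDer_sig_sig]
    simp [hj]

theorem etaDerFun_br (i : Fin m) (u v : Fin 2 → EvenFun m τ ξ) :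
    etaDerFun i (br u v) =
      br (fun A => etaDerFun i (u A)) v + br u fun A => etaDerFun i (v A) := by
  simp only [br, map_sub, Derivation.leibniz, smul_eq_mul]
  ring

theorem br_zero_left {R : Type*} [CommRing R] (v : Fin 2 → R) : br (fun _ => 0) v = 0 := by
  simp [br]

theorem br_zero_right {R : Type*} [CommRing R] (v : Fin 2 → R) : br v (fun _ => 0) = 0 := by
  simp [br]

theorem etaDerFun_sbr_of_ne (i : Fin m) {j k : Particle m} (hj : j ≠ Sum.inr i)
    (hk : k ≠ Sum.inr i) : etaDerFun i (sbr j k : EvenFun m τ ξ) = 0 := by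
  simp only [sbr, etaDerFun_br, etaDerFun_sig_of_ne i hj, etaDerFun_sig_of_ne i hk,
    br_zero_left, br_zero_right, add_zero]

theorem etaDerFun_sbr_right (i : Fin m) {k : Particle m} (hk : k ≠ Sum.inr i) :
    etaDerFun i (sbr k (Sum.inr i) : EvenFun m τ ξ) = br (sig k) (eta ξ i) := by
  simp only [sbr, etaDerFun_br, etaDerFun_sig_of_ne i hk, etaDerFun_sig_self,
    br_zero_left, zero_add]

theorem etaDerFun_sbr_left (i : Fin m) {k : Particle m} (hk : k ≠ Sum.inr i) :
    etaDerFun i (sbr (Sum.inr i) k : EvenFun m τ ξ) = br (eta ξ i) (sig k) := by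
  simp only [sbr, etaDerFun_br, etaDerFun_sig_of_ne i hk, etaDerFun_sig_self,
    br_zero_right, add_zero]

theorem etaDerFun_rbr_of_ne (i : Fin m) {k : Particle m} (hk : k ≠ Sum.inr i) :
    etaDerFun i (rbr ξ k : EvenFun m τ ξ) = 0 := by
  simp only [rbr, etaDerFun_br, etaDerFun_sig_of_ne i hk, etaDerFun_cst, br_zero_left,
    br_zero_right, add_zero]

/-- The factor `(1ξ)(2ξ)`. -/
def refProd (m : ℕ) (τ : Fin 2 → Fin 2 → ℂ) (ξ : Fin 2 → ℂ) : EvenFun m τ ξ :=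
  br (sig (Sum.inl 0)) (cst ξ) * br (sig (Sum.inl 1)) (cst ξ)

/-- The factor `(1ξ)(2i) + (2ξ)(1i)`. -/
def refSum (i : Fin m) : EvenFun m τ ξ :=
  etaCoeff (sig (Sum.inl 0)) (sig (Sum.inl 1)) (cst ξ) (sig (Sum.inr i))

/-- The part of `η_i` along `ξ` drops out of `(ξ η_i)`, leaving the multiple of `σ_i`. -/
theorem etaDerFun_rbr_self (i : Fin m) :
    etaDerFun i (rbr ξ (Sum.inr i) : EvenFun m τ ξ) =
      -(refProd m τ ξ * rbr ξ (Sum.inr i)) := by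
  have h : etaDerFun i (rbr ξ (Sum.inr i) : EvenFun m τ ξ) = br (cst ξ) (eta ξ i) := by
    simp only [rbr, etaDerFun_br, etaDerFun_sig_self, etaDerFun_cst, br_zero_left, zero_add]
  rw [h, eta, br_etaSpinor_right, rbr, refProd]
  simp only [br]
  ring

theorem derivation_ringInverse {R A : Type*} [CommRing R] [CommRing A] [Algebra R A]
    (D : Derivation R A A) {f : A} (hf : IsUnit f) :
    D (Ring.inverse f) = -(Ring.inverse f ^ 2 * D f) := by
  rw [Derivation.leibniz_of_mul_eq_one _ (Ring.inverse_mul_cancel f hf), smul_eq_mul, neg_mul]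

/-- The logarithmic derivative of the entries of the Hodges matrix. -/
def logDer (i j : Fin m) : EvenFun m τ ξ :=
  refProd m τ ξ - refSum i * rbr ξ (Sum.inr j) * Ring.inverse (sbr (Sum.inr i) (Sum.inr j))

/-- By `etaCoeff_antisymm` the pole parts of the two scaling factors add up to a constant, which
cancels the two copies of `(1ξ)(2ξ)`. -/
theorem logDer_antisymm {i j : Fin m} (h : i ≠ j) :
    (logDer i j : EvenFun m τ ξ) = -logDer j i := by
  have h1 := Ring.mul_inverse_cancel _ (isUnit_sbr_inr (τ := τ) (ξ := ξ) h)
  have h2 : refSum i * rbr ξ (Sum.inr j) - refSum j * rbr ξ (Sum.inr i) =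
      2 * refProd m τ ξ * sbr (Sum.inr i) (Sum.inr j) := etaCoeff_antisymm _ _ _ _ _
  rw [logDer, logDer, sbr_swap (Sum.inr j), ringInverse_neg]
  linear_combination (-Ring.inverse (sbr (Sum.inr i) (Sum.inr j))) * h2 -
    2 * refProd m τ ξ * h1

theorem etaDerFun_inverse_sbr {i j : Fin m} (h : j ≠ i) :
    etaDerFun i (Ring.inverse (sbr (Sum.inr i) (Sum.inr j)) : EvenFun m τ ξ) =
      logDer i j * Ring.inverse (sbr (Sum.inr i) (Sum.inr j)) := by
  have h1 := Ring.mul_inverse_cancel _ (isUnit_sbr_inr (τ := τ) (ξ := ξ) h.symm)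
  rw [derivation_ringInverse _ (isUnit_sbr_inr h.symm),
    etaDerFun_sbr_left i (by simpa using h), eta, br_etaSpinor_left]
  change -(_ * (refSum i * rbr ξ (Sum.inr j) -
    refProd m τ ξ * sbr (Sum.inr i) (Sum.inr j))) = _
  rw [logDer]
  linear_combination (refProd m τ ξ * Ring.inverse (sbr (Sum.inr i) (Sum.inr j))) * h1

theorem etaDer_hodgesOffE {i j : Fin m} (h : j ≠ i) (s : ℂ) :
    etaDer i (hodgesOffE s (Sum.inr i) (Sum.inr j) : EvenRing m τ ξ) =
      evE (logDer i j) * hodgesOffE s (Sum.inr i) (Sum.inr j) := by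
  rw [hodgesOffE_eq, map_neg, Derivation.leibniz, etaDer_wbrE, etaDer_evE,
    etaDerFun_inverse_sbr h, map_mul, smul_eq_mul, smul_zero, add_zero]
  ring

theorem etaDer_hodgesOffE_of_ne {i j : Fin m} {k : Particle m} (hj : j ≠ i) (hk : k ≠ Sum.inr i)
    (hkj : k ≠ Sum.inr j) (s : ℂ) :
    etaDer i (hodgesOffE s (Sum.inr j) k : EvenRing m τ ξ) = 0 := by
  rw [hodgesOffE_eq, map_neg, Derivation.leibniz, etaDer_wbrE, etaDer_evE,
    derivation_ringInverse _ (isUnit_sbr hkj), etaDerFun_sbr_of_ne i (by simpa using hj) hk]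
  simp

theorem etaDerFun_inverse_rbr_of_ne {i j : Fin m} (hj : j ≠ i) :
    etaDerFun i (Ring.inverse (rbr ξ (Sum.inr j)) : EvenFun m τ ξ) = 0 := by
  rw [derivation_ringInverse _ (isUnit_rbr j), etaDerFun_rbr_of_ne i (by simpa using hj),
    mul_zero, neg_zero]

theorem etaDerFun_inverse_rbr_sq (i : Fin m) :
    etaDerFun i (Ring.inverse (rbr ξ (Sum.inr i)) ^ 2 : EvenFun m τ ξ) =
      2 * refProd m τ ξ * Ring.inverse (rbr ξ (Sum.inr i)) ^ 2 := by
  have h1 := Ring.mul_inverse_cancel _ (isUnit_rbr (τ := τ) (ξ := ξ) i)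
  rw [pow_two, Derivation.leibniz, derivation_ringInverse _ (isUnit_rbr i), etaDerFun_rbr_self,
    smul_eq_mul]
  linear_combination (2 * refProd m τ ξ * Ring.inverse (rbr ξ (Sum.inr i)) ^ 2) * h1

/-- Only the term `k = i` of the diagonal entry `j` depends on `σ_i`. Its factor `(ξi)²` contributes
the shift by `-2 (1ξ)(2ξ)` to the logarithmic derivative, and is removed by the weight `(ξi)^{-2}`.
-/
theorem etaDer_core_self {i j : Fin m} (hj : j ≠ i) (s : ℂ) :
    evE (Ring.inverse (rbr ξ (Sum.inr i)) ^ 2 : EvenFun m τ ξ) * etaDer i (core s ξ j j) =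
      -((evE (logDer i j) - evE (2 * refProd m τ ξ)) * core s ξ i j *
        evE (Ring.inverse (rbr ξ (Sum.inr j)) ^ 2)) := by
  have hmem : (Sum.inr i : Particle m) ∈ Finset.univ.erase (Sum.inr j : Particle m) := by
    simpa using hj.symm
  rw [core_self, map_neg, map_sum, ← Finset.add_sum_erase _ _ hmem, Finset.sum_eq_zero]
  · have h1 := Ring.mul_inverse_cancel _ (isUnit_rbr (τ := τ) (ξ := ξ) i)
    rw [hodgesOffE_swap s (Sum.inr i) (Sum.inr j), Derivation.leibniz, etaDer_hodgesOffE hj,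
      etaDer_evE, Derivation.leibniz, Derivation.leibniz_pow, Derivation.leibniz_pow,
      etaDerFun_inverse_rbr_of_ne hj, etaDerFun_rbr_self, core_of_ne s ξ hj.symm]
    have h2 := congrArg evE h1
    simp only [smul_eq_mul, nsmul_eq_mul, map_mul, map_pow, map_neg, map_one,
      mul_zero, map_ofNat, Nat.cast_ofNat, Nat.add_one_sub_one, pow_one, zero_add] at h2 ⊢
    linear_combination (-(evE (logDer i j) - 2 * evE (refProd m τ ξ)) *
      hodgesOffE s (Sum.inr i) (Sum.inr j) * evE (Ring.inverse (rbr ξ (Sum.inr j))) ^ 2 *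
      (evE (rbr ξ (Sum.inr i)) * evE (Ring.inverse (rbr ξ (Sum.inr i))) + 1)) * h2
  · intro k hk
    simp only [Finset.mem_erase, Finset.mem_univ, and_true] at hk
    rw [Derivation.leibniz, etaDer_hodgesOffE_of_ne hj hk.1 hk.2, etaDer_evE,
      Derivation.leibniz, Derivation.leibniz_pow, Derivation.leibniz_pow,
      etaDerFun_inverse_rbr_of_ne hj, etaDerFun_rbr_of_ne i hk.1]
    simp

theorem sum_etaDer_adjugate (s : ℂ) (k : Fin m) :
    ∑ i, evE (Ring.inverse (rbr ξ (Sum.inr i)) ^ 2 : EvenFun m τ ξ) *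
        etaDer i ((core s ξ).adjugate k i) +
      evE (2 * refProd m τ ξ) * ∑ i, evE (Ring.inverse (rbr ξ (Sum.inr i)) ^ 2) *
        (core s ξ).adjugate k i =
      evE (2 * refProd m τ ξ) *
        (evE (Ring.inverse (rbr ξ (Sum.inr k)) ^ 2) * (core s ξ).adjugate k k) :=
  Matrix.sum_derivation_adjugate (core_isSymm s ξ) etaDer
    (fun i => evE (Ring.inverse (rbr ξ (Sum.inr i)) ^ 2)) (fun i j => evE (logDer i j)) _
    (fun i j h => by rw [logDer_antisymm h, map_neg])
    (fun i j k hj hk hjk => by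
      rw [core_of_ne s ξ hjk, etaDer_hodgesOffE_of_ne hj (by simpa using hk)
        (by simpa using hjk.symm)])
    (fun i j hj => by rw [core_of_ne s ξ hj.symm, etaDer_hodgesOffE hj])
    (fun i j hj => etaDer_core_self hj s) k

/-- The gradient of `etaCoeff` along `ξ` is `2 (1ξ)(2ξ)`, and the divergence of `σ_i` in two
dimensions is 2, so the two parts of `η_i` cancel. Divergences along `η_i` are therefore plain
directional derivatives. -/
theorem eta_divergence (i : Fin m) :
    ∑ A, evenDer m τ ξ (EvenVar.sig i A) (eta ξ i A) = 0 := by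
  have h1 : ∀ A B, evenDer m τ ξ (EvenVar.sig i A) (sig (Sum.inr i) B) =
      if B = A then 1 else 0 := fun A B => by simp [evenDer_sig_sig]
  simp only [Fin.sum_univ_two, eta, etaSpinor, etaCoeff, br, map_add, map_sub,
    Derivation.leibniz, evenDer_cst, evenDer_sig_inl, h1, smul_eq_mul]
  simp
  ring

theorem sum_sigDer_eta (i : Fin m) (f : EvenRing m τ ξ) :
    ∑ A, sigDer i A (evE (eta ξ i A) * f) = etaDer i f := by
  have h := congrArg (evE (m := m) (τ := τ) (ξ := ξ)) (eta_divergence i)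
  rw [Fin.sum_univ_two, map_add, map_zero, ← sigDer_evE, ← sigDer_evE] at h
  rw [Fin.sum_univ_two, etaDer_apply, Derivation.leibniz, Derivation.leibniz]
  simp only [smul_eq_mul]
  linear_combination f * h

/-- The inverse of `nullVec`. -/
def nullInv (i : Fin m) : EvenFun m τ ξ :=
  Ring.inverse (sbr (Sum.inl 0) (Sum.inr i)) * Ring.inverse (sbr (Sum.inl 1) (Sum.inr i))

theorem nullVec_mul_nullInv (i : Fin m) :
    (nullVec (Sum.inr i) * nullInv i : EvenFun m τ ξ) = 1 := by
  have h0 := Ring.mul_inverse_cancel _ (isUnit_sbr_inl (τ := τ) (ξ := ξ) 0 i)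
  have h1 := Ring.mul_inverse_cancel _ (isUnit_sbr_inl (τ := τ) (ξ := ξ) 1 i)
  rw [nullVec, nullInv, mul_mul_mul_comm, h0, h1, one_mul]

theorem etaDerFun_nullInv_of_ne {i k : Fin m} (h : k ≠ i) :
    etaDerFun i (nullInv k : EvenFun m τ ξ) = 0 := by
  have hp : ∀ p : Fin 2,
      etaDerFun i (Ring.inverse (sbr (Sum.inl p) (Sum.inr k)) : EvenFun m τ ξ) = 0 := fun p => by
    rw [derivation_ringInverse _ (isUnit_sbr_inl p k),
      etaDerFun_sbr_of_ne i (by simp) (by simpa using h), mul_zero, neg_zero]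
  rw [nullInv, Derivation.leibniz, hp, hp, smul_zero, smul_zero, add_zero]

theorem etaDerFun_nullInv (k : Fin m) :
    etaDerFun k (nullInv k : EvenFun m τ ξ) =
      2 * refProd m τ ξ * nullInv k - nullInv k ^ 2 * refSum k ^ 2 := by
  have h := nullVec_mul_nullInv (τ := τ) (ξ := ξ) k
  have hd : etaDerFun k (nullVec (Sum.inr k) : EvenFun m τ ξ) =
      refSum k ^ 2 - 2 * refProd m τ ξ * nullVec (Sum.inr k) := by
    rw [nullVec, Derivation.leibniz, etaDerFun_sbr_right k (by simp),
      etaDerFun_sbr_right k (by simp), eta, br_etaSpinor_right, br_etaSpinor_right, refSum,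
      refProd, etaCoeff, smul_eq_mul, smul_eq_mul, sbr, sbr]
    ring
  rw [Derivation.leibniz_of_mul_eq_one _ ((mul_comm _ _).trans h), hd, smul_eq_mul]
  linear_combination (2 * refProd m τ ξ * nullInv k) * h

/-- The coefficient `(12)² / (1k)²(2k)²` times the minor arises as a divergence. -/
theorem sum_divergence (s : ℂ) (k : Fin m) :
    ∑ i, ∑ A, sigDer i A (evE (eta ξ i A) *
      (evE (Ring.inverse (rbr ξ (Sum.inr i)) ^ 2 * nullInv k) * (core s ξ).adjugate k i)) =
      -(evE (sbr (Sum.inl 0) (Sum.inl 1) ^ 2 * nullInv k ^ 2 : EvenFun m τ ξ) *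
        (core s ξ).adjugate k k) := by
  simp only [sum_sigDer_eta]
  -- The derivative of `(ξi)^{-2}` supplies the `b`-term of the adjugate formula, with `b = 2
  -- (1ξ)(2ξ)`; the derivative of `1/v_k` is present only for `i = k`.
  have hterm : ∀ i, etaDer i (evE (Ring.inverse (rbr ξ (Sum.inr i)) ^ 2 * nullInv k) *
      (core s ξ).adjugate k i) =
      evE (nullInv k) * (evE (Ring.inverse (rbr ξ (Sum.inr i)) ^ 2 : EvenFun m τ ξ) *
        etaDer i ((core s ξ).adjugate k i)) +
      evE (nullInv k) * (evE (2 * refProd m τ ξ) *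
        (evE (Ring.inverse (rbr ξ (Sum.inr i)) ^ 2) * (core s ξ).adjugate k i)) +
      if k = i then evE (Ring.inverse (rbr ξ (Sum.inr i)) ^ 2 * etaDerFun i (nullInv k)) *
        (core s ξ).adjugate k i else 0 := by
    intro i
    rw [Derivation.leibniz, etaDer_evE, Derivation.leibniz, etaDerFun_inverse_rbr_sq]
    split_ifs with h
    · simp only [smul_eq_mul, map_mul, map_add]
      ring
    · rw [etaDerFun_nullInv_of_ne h]
      simp only [smul_eq_mul, map_mul, map_add, map_zero]
      ring
  simp only [hterm, Finset.sum_add_distrib, ← Finset.mul_sum, Finset.sum_ite_eq, Finset.mem_univ,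
    if_true]
  have h1 := sum_etaDer_adjugate (τ := τ) (ξ := ξ) s k
  have h2 := congrArg (evE (m := m) (τ := τ) (ξ := ξ)) (nullVec_mul_nullInv k)
  have h3 := congrArg (evE (m := m) (τ := τ) (ξ := ξ))
    (Ring.mul_inverse_cancel _ (isUnit_rbr (τ := τ) (ξ := ξ) k))
  -- What is left is `-(refSum² - 4 refProd v_k)` times `(ξk)^{-2} v_k^{-2}` and the minor; the
  -- discriminant identity turns the bracket into `(12)² (ξk)²`, so the reference spinor disappears
  -- from the coefficient.
  have h4 : refSum k ^ 2 - 4 * refProd m τ ξ * nullVec (Sum.inr k) =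
      sbr (Sum.inl 0) (Sum.inl 1) ^ 2 * rbr ξ (Sum.inr k) ^ 2 := etaCoeff_sq _ _ _ _
  have h5 := congrArg (evE (m := m) (τ := τ) (ξ := ξ)) h4
  rw [etaDerFun_nullInv]
  simp only [map_mul, map_sub, map_pow, map_one, map_ofNat] at h1 h2 h3 h5 ⊢
  set adj := (core s ξ).adjugate k k
  set u := evE (Ring.inverse (rbr ξ (Sum.inr k)) : EvenFun m τ ξ)
  set N := evE (nullInv k : EvenFun m τ ξ)
  linear_combination N * h1 - adj * u ^ 2 * N ^ 2 * h5 -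
    4 * adj * u ^ 2 * N * evE (refProd m τ ξ) * h2 -
    adj * N ^ 2 * evE (sbr (Sum.inl 0) (Sum.inl 1)) ^ 2 * (evE (rbr ξ (Sum.inr k)) * u + 1) * h3

end MHV

/-! ### Normalized minors modulo a subgroup. -/

/-- The normalized minors of symmetric matrices that agree off the diagonal and have a common null
vector modulo `N` are equal modulo `N`. -/
theorem Matrix.adjugate_sub_mem_of_mulVec_mem {ι R : Type*} [Fintype ι] [DecidableEq ι]
    [CommRing R] [Algebra ℂ R] (S : Subalgebra ℂ R) (N : AddSubgroup R)
    (hN : ∀ z ∈ N, ∀ g ∈ S, g * z ∈ N) {M M' : Matrix ι ι R} {v w : ι → R}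
    (hM : ∀ i j, M i j ∈ S) (hM' : ∀ i j, M' i j ∈ S) (hv : ∀ i, v i ∈ S) (hw : ∀ i, w i ∈ S)
    (hsymm : M.IsSymm) (hoff : ∀ i j, i ≠ j → M i j = M' i j) (hvw : ∀ i, v i * w i = 1)
    (hMv : ∀ i, ∑ j, M i j * v j ∈ N) (hMv' : ∀ i, ∑ j, M' i j * v j ∈ N) (a b c d : ι) :
    w a * w b * M.adjugate a b - w c * w d * M'.adjugate c d ∈ N := by
  -- `N` is stable only under multiplication by `S`, so it need not be an ideal of `R`. Its trace on
  -- `S` is one, and over the quotient of `S` the vector `v` is an honest null vector of both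
  -- matrices.
  let J : Ideal S :=
    { carrier := {x | (x : R) ∈ N}
      add_mem' := fun hx hy => N.add_mem hx hy
      zero_mem' := N.zero_mem
      smul_mem' := fun g x hx => hN x hx g g.2 }
  let f : S →+* S ⧸ J := Ideal.Quotient.mk J
  let P : Matrix ι ι S := fun i j => ⟨M i j, hM i j⟩
  let P' : Matrix ι ι S := fun i j => ⟨M' i j, hM' i j⟩
  let v₁ : ι → S := fun i => ⟨v i, hv i⟩
  let w₁ : ι → S := fun i => ⟨w i, hw i⟩
  have hvw₁ : ∀ i, f (v₁ i) * f (w₁ i) = 1 := fun i => by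
    rw [← map_mul, ← map_one f]
    exact congrArg f (Subtype.ext (hvw i))
  have hker : ∀ (L : Matrix ι ι S), (∀ i, ((∑ j, L i j * v₁ j : S) : R) ∈ N) →
      (f.mapMatrix L).mulVec (fun j => f (v₁ j)) = 0 := fun L hL => by
    ext i
    have : f (∑ j, L i j * v₁ j) = 0 := Ideal.Quotient.eq_zero_iff_mem.2 (hL i)
    rw [map_sum] at this
    simpa [Matrix.mulVec, dotProduct] using this
  have hP := hker P fun i => by
    rw [AddSubmonoidClass.coe_finsetSum]; exact hMv i
  have hP' := hker P' fun i => by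
    rw [AddSubmonoidClass.coe_finsetSum]; exact hMv' i
  have hoff₁ : ∀ i j, i ≠ j → f (P i j) = f (P' i j) := fun i j h =>
    congrArg f (Subtype.ext (hoff i j h))
  have hPP : f.mapMatrix P = f.mapMatrix P' := by
    -- As `v i` is invertible, row `i` of the null-vector equation determines the diagonal entry
    -- from the off-diagonal ones, so the two matrices coincide in the quotient.
    ext i j
    rcases eq_or_ne i j with rfl | h
    · have h1 := (congrFun hP i).trans (congrFun hP' i).symm
      simp only [Matrix.mulVec, dotProduct, RingHom.mapMatrix_apply, Matrix.map_apply] at h1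
      rw [← Finset.add_sum_erase _ _ (Finset.mem_univ i),
        ← Finset.add_sum_erase Finset.univ (fun j => f (P' i j) * f (v₁ j)) (Finset.mem_univ i),
        Finset.sum_congr rfl fun j hj =>
          by rw [hoff₁ i j (Finset.mem_erase.1 hj).1.symm]] at h1
      have h2 := add_right_cancel h1
      calc f (P i i) = f (P i i) * f (v₁ i) * f (w₁ i) := by rw [mul_assoc, hvw₁, mul_one]
        _ = f (P' i i) := by rw [h2, mul_assoc, hvw₁, mul_one]
    · exact hoff₁ i j h
  have hsymm₁ : (f.mapMatrix P).IsSymm := by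
    ext i j
    exact congrArg f (Subtype.ext (hsymm.apply i j))
  have key := Matrix.adjugate_mul_mul_of_mulVec_eq_zero hsymm₁ hP a b c d
  have hadj : ∀ (L : Matrix ι ι S) i j, (f.mapMatrix L).adjugate i j = f (L.adjugate i j) :=
    fun L i j => by rw [← RingHom.map_adjugate]; rfl
  have key' : f (w₁ a * w₁ b * P.adjugate a b) = f (w₁ c * w₁ d * P'.adjugate c d) := by
    rw [map_mul, map_mul, map_mul, map_mul, ← hadj, ← hadj, ← hPP]
    calc f (w₁ a) * f (w₁ b) * (f.mapMatrix P).adjugate a b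
        = f (w₁ a) * f (w₁ b) * ((f.mapMatrix P).adjugate a b * (f (v₁ c) * f (v₁ d))) *
          (f (w₁ c) * f (w₁ d)) := by
          linear_combination (-(f (w₁ a) * f (w₁ b) * (f.mapMatrix P).adjugate a b) *
            (f (v₁ d) * f (w₁ d))) * hvw₁ c -
            (f (w₁ a) * f (w₁ b) * (f.mapMatrix P).adjugate a b) * hvw₁ d
      _ = f (w₁ c) * f (w₁ d) * (f.mapMatrix P).adjugate c d := by
          rw [key]
          linear_combination (f (w₁ c) * f (w₁ d) * (f.mapMatrix P).adjugate c d *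
            (f (v₁ b) * f (w₁ b))) * hvw₁ a +
            (f (w₁ c) * f (w₁ d) * (f.mapMatrix P).adjugate c d) * hvw₁ b
  have hmem : w₁ a * w₁ b * P.adjugate a b - w₁ c * w₁ d * P'.adjugate c d ∈ J :=
    Ideal.Quotient.eq.1 key'
  have hval : ∀ (L : Matrix ι ι S) i j,
      ((L.adjugate i j : S) : R) = (L.map (fun x => (x : R))).adjugate i j := fun L i j => by
    have := congrFun (congrFun (RingHom.map_adjugate S.val.toRingHom L) i) j
    exact this
  have h := show ((w₁ a * w₁ b * P.adjugate a b - w₁ c * w₁ d * P'.adjugate c d : S) : R) ∈ N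
    from hmem
  rw [Subalgebra.coe_sub, Subalgebra.coe_mul, Subalgebra.coe_mul, Subalgebra.coe_mul,
    Subalgebra.coe_mul, hval, hval] at h
  exact h

namespace MHV

variable {m : ℕ} {τ : Fin 2 → Fin 2 → ℂ} {ξ : Fin 2 → ℂ}

/-! ### The integral on the ring of even integrands -/

/-- `integral` as a linear map on `EvenRing`. -/
def integralE : EvenRing m τ ξ →ₗ[ℂ] IntegralValue m τ ξ :=
  (totalDerivatives m τ ξ).mkQ ∘ₗ incl.toLinearMap ∘ₗ
    LinearMap.mulLeft ℂ (evE (br (sig (Sum.inl 0)) (sig (Sum.inl 1)) ^ 2))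

/-- The Faddeev-Popov factor `(12)²` is a complex number because `σ₁, σ₂` are fixed, so
multiplication by it preserves the space of total derivatives. -/
theorem integralE_eq_zero {F : EvenRing m τ ξ} (h : incl F ∈ totalDerivatives m τ ξ) :
    integralE F = 0 := by
  have hc : evE (br (sig (Sum.inl 0)) (sig (Sum.inl 1)) ^ 2 : EvenFun m τ ξ) =
      algebraMap ℂ (EvenRing m τ ξ) (br (τ 0) (τ 1) ^ 2) := by
    have h0 : (br (sig (Sum.inl 0)) (sig (Sum.inl 1)) : EvenFun m τ ξ) =
        algebraMap ℂ _ (br (τ 0) (τ 1)) := by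
      simp only [br, sig_inl, cst, map_sub, map_mul]
    rw [h0, ← map_pow, AlgHom.commutes]
  change (totalDerivatives m τ ξ).mkQ (incl (_ * F)) = 0
  rw [hc, ← Algebra.smul_def, map_smul, map_smul, Submodule.mkQ_apply,
    (Submodule.Quotient.mk_eq_zero _).2 h, smul_zero]

/-- `reduced` with values in `EvenRing`. -/
def reducedE (s : ℂ) (ζ : Fin 2 → ℂ) (T : Finset (Fin m)) : EvenRing m τ ξ := reduced s ζ T

theorem reducedE_eq (s : ℂ) (ζ : Fin 2 → ℂ) (T : Finset (Fin m)) :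
    (reducedE s ζ T : EvenRing m τ ξ) =
      ((core s ζ).submatrix (fun i : {i : Fin m // i ∉ T} => i.1)
        (fun i : {i : Fin m // i ∉ T} => i.1)).det := by rfl

theorem reducedE_empty (s : ℂ) (ζ : Fin 2 → ℂ) :
    (reducedE s ζ ∅ : EvenRing m τ ξ) = (core s ζ).det := by
  rw [reducedE_eq]
  exact Matrix.det_submatrix_equiv_self
    (Equiv.subtypeUnivEquiv fun i : Fin m => Finset.notMem_empty i) _

theorem reducedE_singleton (s : ℂ) (ζ : Fin 2 → ℂ) (i : Fin m) :
    (reducedE s ζ {i} : EvenRing m τ ξ) = (core s ζ).adjugate i i := by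
  rw [reducedE_eq, Matrix.det_submatrix_compl_singleton]

/-- `coeff` with values in `EvenRing`. -/
def coeffE (i j : Fin m) : EvenRing m τ ξ :=
  evE (sbr (Sum.inl 0) (Sum.inl 1) ^ 2 * nullInv i * nullInv j)

theorem coeff_eq (i j : Fin m) : (coeff i j : Even m τ ξ) = (coeffE i j : EvenRing m τ ξ) := by
  have h : (sbr (Sum.inl 0) (Sum.inl 1) ^ 2 *
    Ring.inverse (sbr (Sum.inl 0) (Sum.inr i)) * Ring.inverse (sbr (Sum.inl 0) (Sum.inr j)) *
    Ring.inverse (sbr (Sum.inl 1) (Sum.inr i)) * Ring.inverse (sbr (Sum.inl 1) (Sum.inr j)) :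
      EvenFun m τ ξ) = sbr (Sum.inl 0) (Sum.inl 1) ^ 2 * nullInv i * nullInv j := by
    rw [nullInv, nullInv]; ring
  exact congrArg ev h

/-- `omegaTerm` with values in `EvenRing`. -/
def omegaTermE (s : ℂ) : EvenRing m τ ξ := omegaTerm s

theorem amplitude_eq (s : ℂ) : amplitude m τ ξ s =
    (s ^ 2)⁻¹ • integralE (xsqE s ^ 2 * reducedE s ξ ∅ + omegaTermE s) := by rfl

theorem thriceReduced_eq (s : ℂ) (i : Fin m) : thriceReduced m τ ξ s i =
    integralE ((-2 : ℂ) • (xsqE s * coeffE i i * reducedE s ξ {i}) +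
      (s ^ 2)⁻¹ • omegaTermE s) := by
  rw [thriceReduced, coeff_eq]; rfl

theorem hodgesAmplitude_eq (ζ : Fin 2 → ℂ) (i : Fin m) : hodgesAmplitude m τ ξ ζ i =
    integralE (xsqE 0 * coeffE i i * reducedE 0 ζ {i}) := by
  rw [hodgesAmplitude, coeff_eq]; rfl

theorem flatSum_eq (ζ : Fin 2 → ℂ) : flatSum m τ ξ ζ =
    integralE (xsqE 0 * (∑ i : Fin m, ∑ j : Fin m, coeffE i j * (core 0 ζ).adjugate j i +
      ∑ i : Fin m, coeffE i i * reducedE 0 ζ {i})) := by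
  simp only [flatSum, coeff_eq]; rfl

theorem core_mem_xFree (s : ℂ) (ζ : Fin 2 → ℂ) (i j : Fin m) : core s ζ i j ∈ xFree m τ ξ :=
  hodgesE_mem_xFree s ζ _ _

theorem det_mem_of_forall_mem {ι R : Type*} [Fintype ι] [DecidableEq ι] [CommRing R]
    [Algebra ℂ R] (S : Subalgebra ℂ R) {M : Matrix ι ι R} (hM : ∀ i j, M i j ∈ S) :
    M.det ∈ S := by
  rw [Matrix.det_apply]
  exact sum_mem fun σ _ => by
    rw [Units.smul_def]
    exact zsmul_mem (prod_mem fun i _ => hM _ _) _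

theorem adjugate_core_mem_xFree (s : ℂ) (ζ : Fin 2 → ℂ) (i j : Fin m) :
    (core s ζ).adjugate i j ∈ xFree m τ ξ := by
  rw [Matrix.adjugate_apply]
  refine det_mem_of_forall_mem _ fun a b => ?_
  rw [Matrix.updateRow_apply, Pi.single_apply]
  split_ifs
  · exact one_mem _
  · exact zero_mem _
  · exact core_mem_xFree s ζ a b

theorem inverse_rbr_mem_xFreeFun (ζ : Fin 2 → ℂ) (i : Particle m) :
    Ring.inverse (rbr ζ i) ∈ xFreeFun m τ ξ :=
  ringInverse_mem_xFreeFun (rbr_mem_xFreeFun ζ i)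

theorem nullInv_mem_xFreeFun (i : Fin m) : nullInv i ∈ xFreeFun m τ ξ :=
  mul_mem (ringInverse_mem_xFreeFun (sbr_mem_xFreeFun _ _))
    (ringInverse_mem_xFreeFun (sbr_mem_xFreeFun _ _))

/-! ### The thrice-reduced form -/

/-- Apply `adj H * H = det H • 1` to the vector `v`, read off component `k` and divide by the unit
`v_k`; each `(H v)_i` is a momentum factor. -/
theorem det_core_eq (s : ℂ) (k : Fin m) : ((core s ξ).det : EvenRing m τ ξ) =
    ∑ i, momentumAt s (Sum.inr i) (eta ξ i) *
      (evE (Ring.inverse (rbr ξ (Sum.inr i)) ^ 2 * nullInv k) * (core s ξ).adjugate k i) := by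
  have h1 : ∑ i, (core s ξ).adjugate k i *
      ∑ j, core s ξ i j * evE (nullVec (Sum.inr j) : EvenFun m τ ξ) =
      (core s ξ).det * evE (nullVec (Sum.inr k)) := by
    have h := congrFun (congrArg (fun L : Matrix (Fin m) (Fin m) (EvenRing m τ ξ) =>
      L.mulVec fun j => evE (nullVec (Sum.inr j))) (Matrix.adjugate_mul (core s ξ))) k
    rw [← Matrix.mulVec_mulVec, Matrix.smul_mulVec, Matrix.one_mulVec] at h
    exact h
  have h2 := congrArg (evE (m := m) (τ := τ) (ξ := ξ)) (nullVec_mul_nullInv k)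
  rw [map_mul, map_one] at h2
  rw [← mul_one (core s ξ).det, ← h2, ← mul_assoc, ← h1, Finset.sum_mul]
  refine Finset.sum_congr rfl fun i _ => ?_
  rw [core_mulVec_nullVec s ξ i (isUnit_rbr i), map_mul]
  ring

theorem integralE_xsqE_sq_mul_det (s : ℂ) (k : Fin m) :
    integralE (xsqE s ^ 2 * (core s ξ).det : EvenRing m τ ξ) =
      (s ^ 2) • integralE ((-2 : ℂ) • (xsqE s * coeffE k k * (core s ξ).adjugate k k)) := by
  rw [← map_smul, ← sub_eq_zero, ← map_sub]
  apply integralE_eq_zero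
  have h := sum_mem (t := Finset.univ) fun (i : Fin m) _ =>
    xsqE_sq_mul_momentumAt_mem s i (eta_mem_xFreeFun (τ := τ) (ξ := ξ) ξ i)
      (mul_mem (evE_mem_xFree (mul_mem (pow_mem (inverse_rbr_mem_xFreeFun ξ (Sum.inr i)) 2)
        (nullInv_mem_xFreeFun k))) (adjugate_core_mem_xFree s ξ k i))
  rw [← map_sum, Finset.sum_sub_distrib, ← Finset.mul_sum, ← det_core_eq, ← Finset.smul_sum,
    ← Finset.mul_sum, sum_divergence] at h
  convert h using 2
  rw [coeffE, smul_smul, mul_assoc _ (nullInv k) (nullInv k), ← pow_two (nullInv k)]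
  simp only [Algebra.smul_def, map_mul, map_pow, map_neg, map_ofNat]
  ring

theorem amplitude_eq_thriceReduced {s : ℂ} (hs : s ≠ 0) (i : Fin m) :
    amplitude m τ ξ s = thriceReduced m τ ξ s i := by
  rw [amplitude_eq, thriceReduced_eq, reducedE_empty, reducedE_singleton, map_add, map_add,
    integralE_xsqE_sq_mul_det s i, smul_add, smul_smul, inv_mul_cancel₀ (pow_ne_zero 2 hs),
    one_smul, map_smul integralE (s ^ 2)⁻¹]

/-! ### The flat-space formulas -/

/-- The elements whose product with `X²` integrates to zero against all functions that do not
depend on `X`, at `Λ = 0`. -/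
def flatNull (m : ℕ) (τ : Fin 2 → Fin 2 → ℂ) (ξ : Fin 2 → ℂ) : AddSubgroup (EvenRing m τ ξ) where
  carrier := {z | ∀ g ∈ xFree m τ ξ, incl (xsqE 0 * (z * g)) ∈ totalDerivatives m τ ξ}
  add_mem' {x y} hx hy g hg := by
    rw [add_mul, mul_add, map_add]
    exact add_mem (hx g hg) (hy g hg)
  zero_mem' g _ := by
    rw [zero_mul, mul_zero, map_zero]
    exact zero_mem _
  neg_mem' {x} hx g hg := by
    rw [neg_mul, mul_neg, map_neg]
    exact neg_mem (hx g hg)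

theorem mul_mem_flatNull {z g : EvenRing m τ ξ} (hz : z ∈ flatNull m τ ξ)
    (hg : g ∈ xFree m τ ξ) : g * z ∈ flatNull m τ ξ := fun g' hg' => by
  rw [mul_comm g z, mul_assoc]
  exact hz _ (mul_mem hg hg')

theorem momentumAt_mem_flatNull (i : Particle m) {η : Fin 2 → EvenFun m τ ξ}
    (hη : ∀ A, η A ∈ xFreeFun m τ ξ) : momentumAt 0 i η ∈ flatNull m τ ξ := by
  have h : ∀ A, momentum 0 i A ∈ flatNull m τ ξ := fun A g hg => xsqE_zero_mul_momentum_mem i A hg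
  rw [momentumAt_eq]
  exact sub_mem (mul_mem_flatNull (h 1) (evE_mem_xFree (hη 0)))
    (mul_mem_flatNull (h 0) (evE_mem_xFree (hη 1)))

theorem core_mulVec_mem_flatNull (ζ : Fin 2 → ℂ)
    (hζ : ∀ i : Fin m, IsUnit (rbr ζ (Sum.inr i) : EvenFun m τ ξ)) (i : Fin m) :
    ∑ j, core 0 ζ i j * evE (nullVec (Sum.inr j)) ∈ flatNull m τ ξ := by
  rw [core_mulVec_nullVec 0 ζ i (hζ i)]
  exact mul_mem_flatNull (momentumAt_mem_flatNull _ (eta_mem_xFreeFun ζ i))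
    (evE_mem_xFree (pow_mem (inverse_rbr_mem_xFreeFun ζ _) 2))

/-- The reference spinor enters only the diagonal of the matrix, so the result on minors modulo
`flatNull` changes the removed row, the removed column and the reference spinor simultaneously. -/
theorem integralE_flat_eq {ζ ζ' : Fin 2 → ℂ}
    (hζ : ∀ i : Fin m, IsUnit (rbr ζ (Sum.inr i) : EvenFun m τ ξ))
    (hζ' : ∀ i : Fin m, IsUnit (rbr ζ' (Sum.inr i) : EvenFun m τ ξ)) (a b c d : Fin m) :
    integralE (xsqE 0 * (coeffE a b * (core 0 ζ).adjugate b a) : EvenRing m τ ξ) =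
      integralE (xsqE 0 * (coeffE c d * (core 0 ζ').adjugate d c)) := by
  have h := Matrix.adjugate_sub_mem_of_mulVec_mem (xFree m τ ξ) (flatNull m τ ξ)
    (fun z hz g hg => mul_mem_flatNull hz hg) (core_mem_xFree 0 ζ) (core_mem_xFree 0 ζ')
    (v := fun i => evE (nullVec (Sum.inr i))) (w := fun i => evE (nullInv i))
    (fun i => evE_mem_xFree (mul_mem (sbr_mem_xFreeFun _ _) (sbr_mem_xFreeFun _ _)))
    (fun i => evE_mem_xFree (nullInv_mem_xFreeFun i)) (core_isSymm 0 ζ)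
    (fun i j hij => by rw [core_of_ne 0 ζ hij, core_of_ne 0 ζ' hij])
    (fun i => by rw [← map_mul, nullVec_mul_nullInv, map_one])
    (core_mulVec_mem_flatNull ζ hζ) (core_mulVec_mem_flatNull ζ' hζ') b a d c
  have h' := h (evE (sbr (Sum.inl 0) (Sum.inl 1) ^ 2))
    (evE_mem_xFree (pow_mem (sbr_mem_xFreeFun _ _) 2))
  rw [← sub_eq_zero, ← map_sub]
  apply integralE_eq_zero
  convert h' using 2
  simp only [coeffE, map_mul]
  ring

theorem hodgesAmplitude_eq_hodgesAmplitude {ζ ζ' : Fin 2 → ℂ}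
    (hζ : ∀ i : Fin m, IsUnit (rbr ζ (Sum.inr i) : EvenFun m τ ξ))
    (hζ' : ∀ i : Fin m, IsUnit (rbr ζ' (Sum.inr i) : EvenFun m τ ξ)) (i j : Fin m) :
    hodgesAmplitude m τ ξ ζ i = hodgesAmplitude m τ ξ ζ' j := by
  rw [hodgesAmplitude_eq, hodgesAmplitude_eq, reducedE_singleton, reducedE_singleton, mul_assoc,
    mul_assoc, integralE_flat_eq hζ hζ' i i j j]

/-- All `m²` terms of the double sum and the `m` terms of the single sum have the same integral. -/
theorem flatSum_eq_smul {ζ : Fin 2 → ℂ}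
    (hζ : ∀ i : Fin m, IsUnit (rbr ζ (Sum.inr i) : EvenFun m τ ξ)) (k : Fin m) :
    flatSum m τ ξ ζ = (m * (m + 1) : ℂ) • hodgesAmplitude m τ ξ ζ k := by
  have h : ∀ i j : Fin m, integralE (xsqE 0 * (coeffE i j * (core 0 ζ).adjugate j i)) =
      hodgesAmplitude m τ ξ ζ k := fun i j => by
    rw [hodgesAmplitude_eq, reducedE_singleton, mul_assoc, integralE_flat_eq hζ hζ i j k k]
  simp only [flatSum_eq, reducedE_singleton, mul_add, Finset.mul_sum, map_add, map_sum, h,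
    Finset.sum_const, Finset.card_univ, Fintype.card_fin, ← Nat.cast_smul_eq_nsmul ℂ, smul_smul,
    ← add_smul]
  congr 1
  ring

/-! ### Polynomial dependence on `s` -/

section PolynomialDependence

variable {R : Type*} [CommRing R] [Algebra ℂ R]

/-- `f s` is given by a polynomial in `s` with coefficients in `R`. -/
def IsPolyIn (f : ℂ → R) : Prop :=
  ∃ p : Polynomial R, ∀ s, f s = p.eval (algebraMap ℂ R s)

theorem IsPolyIn.const (x : R) : IsPolyIn fun _ => x := ⟨Polynomial.C x, fun s => by simp⟩

theorem IsPolyIn.add {f g : ℂ → R} (hf : IsPolyIn f) (hg : IsPolyIn g) :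
    IsPolyIn fun s => f s + g s := by
  obtain ⟨p, hp⟩ := hf
  obtain ⟨q, hq⟩ := hg
  exact ⟨p + q, fun s => by simp only [hp, hq, Polynomial.eval_add]⟩

theorem IsPolyIn.mul {f g : ℂ → R} (hf : IsPolyIn f) (hg : IsPolyIn g) :
    IsPolyIn fun s => f s * g s := by
  obtain ⟨p, hp⟩ := hf
  obtain ⟨q, hq⟩ := hg
  exact ⟨p * q, fun s => by simp only [hp, hq, Polynomial.eval_mul]⟩

theorem IsPolyIn.neg {f : ℂ → R} (hf : IsPolyIn f) : IsPolyIn fun s => -f s := by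
  obtain ⟨p, hp⟩ := hf
  exact ⟨-p, fun s => by simp only [hp, Polynomial.eval_neg]⟩

theorem IsPolyIn.sub {f g : ℂ → R} (hf : IsPolyIn f) (hg : IsPolyIn g) :
    IsPolyIn fun s => f s - g s := by
  simpa only [sub_eq_add_neg] using hf.add hg.neg

theorem IsPolyIn.sum {κ : Type*} (t : Finset κ) {f : κ → ℂ → R}
    (hf : ∀ k, IsPolyIn (f k)) : IsPolyIn fun s => ∑ k ∈ t, f k s := by
  choose p hp using hf
  exact ⟨∑ k ∈ t, p k, fun s => by simp only [hp, Polynomial.eval_finsetSum]⟩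

theorem IsPolyIn.smul {c : ℂ → ℂ} {f : ℂ → R} (hc : IsPolyIn c) (hf : IsPolyIn f) :
    IsPolyIn fun s => c s • f s := by
  obtain ⟨p, hp⟩ := hc
  obtain ⟨q, hq⟩ := hf
  refine ⟨p.map (algebraMap ℂ R) * q, fun s => ?_⟩
  beta_reduce
  rw [hp, hq, Polynomial.eval_mul, Polynomial.eval_map, Polynomial.eval₂_at_apply,
    Algebra.smul_def]
  rfl

theorem IsPolyIn.pow_id (n : ℕ) : IsPolyIn fun s : ℂ => s ^ n :=
  ⟨Polynomial.X ^ n, fun s => by simp⟩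

theorem IsPolyIn.det {κ : Type*} [Fintype κ] [DecidableEq κ] {M : ℂ → Matrix κ κ R}
    (hM : ∀ i j, IsPolyIn fun s => M s i j) : IsPolyIn fun s => (M s).det := by
  choose p hp using hM
  refine ⟨(Matrix.of p).det, fun s => ?_⟩
  rw [← Polynomial.coe_evalRingHom, RingHom.map_det]
  refine congrArg Matrix.det ?_
  ext i j
  exact hp i j s

end PolynomialDependence

theorem isPolyIn_infUpper (α β : Fin 4) : IsPolyIn fun s => infUpper (s ^ 2) α β := by
  have h := IsPolyIn.pow_id 2
  have h0 := IsPolyIn.const (R := ℂ) 0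
  have h1 := IsPolyIn.const (R := ℂ) 1
  fin_cases α <;> fin_cases β <;>
    first | exact h0 | exact h | exact h.neg | exact h1 | exact h1.neg

theorem isPolyIn_infLower (α β : Fin 4) : IsPolyIn fun s => infLower (s ^ 2) α β := by
  have h := IsPolyIn.pow_id 2
  have h0 := IsPolyIn.const (R := ℂ) 0
  have h1 := IsPolyIn.const (R := ℂ) 1
  fin_cases α <;> fin_cases β <;>
    first | exact h0 | exact h | exact h.neg | exact h1 | exact h1.neg

theorem isPolyIn_id : IsPolyIn fun s : ℂ => s := by simpa using IsPolyIn.pow_id 1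

theorem isPolyIn_wbrE (i j : Particle m) : IsPolyIn fun s => (wbrE s i j : EvenRing m τ ξ) := by
  simp only [wbrE_eq]
  exact (IsPolyIn.sum _ fun α => IsPolyIn.sum _ fun β =>
    (isPolyIn_infUpper α β).smul (IsPolyIn.const _)).sub (isPolyIn_id.smul (IsPolyIn.const _))

theorem isPolyIn_xsqE : IsPolyIn fun s => (xsqE s : EvenRing m τ ξ) := by
  simp only [xsqE_eq]
  exact (IsPolyIn.sum _ fun α => IsPolyIn.sum _ fun β =>
    (isPolyIn_infLower α β).smul (IsPolyIn.const _)).add (isPolyIn_id.smul (IsPolyIn.const _))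

theorem isPolyIn_hodgesOffE (i j : Particle m) :
    IsPolyIn fun s => (hodgesOffE s i j : EvenRing m τ ξ) := by
  simp only [hodgesOffE_eq]
  exact ((isPolyIn_wbrE i j).mul (IsPolyIn.const _)).neg

theorem isPolyIn_core (ζ : Fin 2 → ℂ) (i j : Fin m) :
    IsPolyIn fun s => (core s ζ i j : EvenRing m τ ξ) := by
  rcases eq_or_ne i j with rfl | h
  · simp only [core_self]
    exact (IsPolyIn.sum _ fun k => (isPolyIn_hodgesOffE _ k).mul (IsPolyIn.const _)).neg
  · simp only [core_of_ne _ ζ h]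
    exact isPolyIn_hodgesOffE _ _

theorem isPolyIn_reducedE (ζ : Fin 2 → ℂ) (T : Finset (Fin m)) :
    IsPolyIn fun s => (reducedE s ζ T : EvenRing m τ ξ) := by
  simp only [reducedE_eq]
  exact IsPolyIn.det fun i j => isPolyIn_core ζ i.1 j.1

/-- The propagator `omega` without its factor `Λ`. -/
def omegaCore (s : ℂ) (p : Fin 2) (i j : Fin m) : EvenRing m τ ξ :=
  wbrE s (Sum.inr i) (Sum.inr j) *
    evE (rbr ξ (Sum.inl p) ^ 4 * sbr (Sum.inr i) (Sum.inr j) *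
      Ring.inverse (sbr (Sum.inl p) (Sum.inr i)) ^ 2 *
      Ring.inverse (sbr (Sum.inl p) (Sum.inr j)) ^ 2 *
      Ring.inverse (rbr ξ (Sum.inr i)) ^ 2 * Ring.inverse (rbr ξ (Sum.inr j)) ^ 2)

/-- Each of the two propagators contributes a factor `Λ`, so one power of `Λ` survives the division
by `Λ` and the term drops out at `s = 0`. -/
theorem omegaTermE_eq (s : ℂ) : (omegaTermE s : EvenRing m τ ξ) =
    s ^ 4 • ∑ t : Fin 4 ↪ Fin m, omegaCore s 0 (t 0) (t 1) * omegaCore s 1 (t 2) (t 3) *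
      reducedE s ξ (Finset.univ.map t) := by
  have h : (omegaTermE s : EvenRing m τ ξ) = ∑ t : Fin 4 ↪ Fin m,
      (s ^ 2 • omegaCore s 0 (t 0) (t 1)) * (s ^ 2 • omegaCore s 1 (t 2) (t 3)) *
        reducedE s ξ (Finset.univ.map t) := by rfl
  rw [h, Finset.smul_sum]
  refine Finset.sum_congr rfl fun t _ => ?_
  rw [smul_mul_smul_comm, smul_mul_assoc, ← pow_add]

theorem isPolyIn_thriceReduced (i : Fin m) :
    ∃ F : ℂ → EvenRing m τ ξ, IsPolyIn F ∧
      (∀ s, s ≠ 0 → thriceReduced m τ ξ s i = integralE (F s)) ∧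
      integralE (F 0) = (-2 : ℂ) • hodgesAmplitude m τ ξ ξ i := by
  refine ⟨fun s => (-2 : ℂ) • (xsqE s * coeffE i i * reducedE s ξ {i}) + s ^ 2 •
    ∑ t : Fin 4 ↪ Fin m, omegaCore s 0 (t 0) (t 1) * omegaCore s 1 (t 2) (t 3) *
      reducedE s ξ (Finset.univ.map t), ?_, fun s hs => ?_, ?_⟩
  · have hω : ∀ (p : Fin 2) (i j : Fin m),
        IsPolyIn fun s => (omegaCore s p i j : EvenRing m τ ξ) :=
      fun p i j => (isPolyIn_wbrE _ _).mul (IsPolyIn.const _)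
    exact ((IsPolyIn.const _).smul ((isPolyIn_xsqE.mul (IsPolyIn.const _)).mul
      (isPolyIn_reducedE ξ _))).add ((IsPolyIn.pow_id 2).smul (IsPolyIn.sum _ fun t =>
        ((hω 0 _ _).mul (hω 1 _ _)).mul (isPolyIn_reducedE ξ _)))
  · have h4 : (s ^ 2)⁻¹ * s ^ 4 = s ^ 2 := by field_simp
    rw [thriceReduced_eq, omegaTermE_eq, smul_smul, h4]
  · beta_reduce
    rw [hodgesAmplitude_eq, ← map_smul, zero_pow two_ne_zero, zero_smul, add_zero]

/-- The polynomial is evaluated at complex scalars only, so the ℂ-linear integral can be applied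
coefficient by coefficient. -/
theorem exists_coefficients {F : ℂ → EvenRing m τ ξ} (hF : IsPolyIn F) :
    ∃ c : ℕ →₀ IntegralValue m τ ξ,
      (∀ s, integralE (F s) = c.sum fun d v => s ^ d • v) ∧ c 0 = integralE (F 0) := by
  obtain ⟨p, hp⟩ := hF
  refine ⟨Finsupp.onFinset p.support (fun d => integralE (p.coeff d)) fun d hd => ?_,
    fun s => ?_, ?_⟩
  · rw [Polynomial.mem_support_iff]
    intro h0
    exact hd (by rw [h0, map_zero])
  · rw [Finsupp.onFinset_sum _ (fun d => smul_zero _), hp, Polynomial.eval_eq_sum,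
      Polynomial.sum, map_sum]
    refine Finset.sum_congr rfl fun d _ => ?_
    rw [← map_pow, mul_comm, ← Algebra.smul_def, map_smul]
  · rw [Finsupp.onFinset_apply, hp, map_zero, ← Polynomial.coeff_zero_eq_eval_zero]

end MHV

end

/-! ### The main theorem. -/

theorem mainTheorem3 (m : ℕ) (hm : 1 ≤ m) (τ : Fin 2 → Fin 2 → ℂ) (hτ : MHV.br (τ 0) (τ 1) ≠ 0)
    (ξ : Fin 2 → ℂ) (hξ : ξ ≠ 0) :
    (∀ s : ℂ, s ≠ 0 → ∀ i : Fin m,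
      MHV.amplitude m τ ξ s = MHV.thriceReduced m τ ξ s i) ∧
    ∃ c : ℕ →₀ MHV.IntegralValue m τ ξ,
      (∀ s : ℂ, s ≠ 0 → MHV.amplitude m τ ξ s = c.sum fun d v => s ^ d • v) ∧
      ∀ ζ : Fin 2 → ℂ,
        (∀ i : Fin m, IsUnit (MHV.rbr ζ (Sum.inr i) : MHV.EvenFun m τ ξ)) →
        c 0 = (-2 / (m * (m + 1)) : ℂ) • MHV.flatSum m τ ξ ζ ∧
        ∀ i : Fin m, c 0 = (-2 : ℂ) • MHV.hodgesAmplitude m τ ξ ζ i := by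
  refine ⟨fun s hs i => MHV.amplitude_eq_thriceReduced hs i, ?_⟩
  -- Any particle of positive helicity serves to define the coefficients.
  let k : Fin m := ⟨0, hm⟩
  obtain ⟨F, hF, hFs, hF0⟩ := MHV.isPolyIn_thriceReduced (τ := τ) (ξ := ξ) k
  obtain ⟨c, hc, hc0⟩ := MHV.exists_coefficients hF
  refine ⟨c, fun s hs => ?_, fun ζ hζ => ?_⟩
  · rw [MHV.amplitude_eq_thriceReduced hs k, hFs s hs, hc s]
  · have h : ∀ i : Fin m, c 0 = (-2 : ℂ) • MHV.hodgesAmplitude m τ ξ ζ i := fun i => by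
      -- The constant coefficient is Hodges' formula for `ξ` and `k`; the products `(ξj)` are units
      -- because they divide the inverted denominator, so one may pass to `ζ` and `i`.
      rw [hc0, hF0, MHV.hodgesAmplitude_eq_hodgesAmplitude MHV.isUnit_rbr hζ k i]
    refine ⟨?_, h⟩
    have h1 : (m : ℂ) ≠ 0 := Nat.cast_ne_zero.2 (Nat.one_le_iff_ne_zero.1 hm)
    have h2 : (m : ℂ) + 1 ≠ 0 := Nat.cast_add_one_ne_zero m
    rw [h k, MHV.flatSum_eq_smul hζ k, smul_smul, div_mul_cancel₀ _ (mul_ne_zero h1 h2)]
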